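/- **Setting.** Let $m,q,p\ge 1$, all spaces Euclidean, products with the Euclidean product norm. Let $F:\mathbb R^p\to\mathbb R\cup\{+\infty\}$ and $G:\mathbb R^q\to\mathbb R\cup\{+\infty\}$ be proper, lower semicontinuous and bounded from below, let $H:\mathbb R^m\times\mathbb R^q\to\mathbb R$ be Fréchet differentiable and bounded from below, and let $A:\mathbb R^m\to\mathbb R^p$ be linear and surjective. Let $\mu,\beta,\tau>0$, $0<\sigma\le 1$, and let $(x_n,y_n,z_n,u_n)_{n\ge0}$ be a bounded sequence in $\mathbb R^m\times\mathbb R^q\times\mathbb R^p\times\mathbb R^p$ such that for all $n\ge 0$ $$y_{n+1}\in\arg\min_y\Big\{G(y)+\langle\nabla_yH(x_n,y_n),y\rangle+\tfrac\mu2\|y-y_n\|^2\Big\},$$ $$z_{n+1}\in\arg\min_z\Big\{F(z)+\langle u_n,Ax_n-z\rangle+\tfrac\beta2\|Ax_n-z\|^2\Big\},$$ $$x_{n+1}=x_n-\tau^{-1}\big(\nabla_xH(x_n,y_{n+1})+A^Tu_n+\beta A^T(Ax_n-z_{n+1})\big),\qquad u_{n+1}=u_n+\sigma\beta(Ax_{n+1}-z_{n+1}).$$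 Suppose that $\nabla H$ is Lipschitz continuous with constant $L>0$ on a bounded convex set $B_1\times B_2\subseteq\mathbb R^m\times\mathbb R^q$ containing all $(x_n,y_n)$. Let $\lambda$ be the smallest eigenvalue of $AA^T$, and suppose that $2\tau\ge\beta\|A\|^2$ and $\min\{C_2,C_3,C_4\}>0$, where $$C_2=\tau-\frac{L\sqrt2+\beta\|A\|^2}{2}-\frac{4\sigma\tau^2}{\beta\lambda}-\frac{8(\sigma\tau+L\sqrt2)^2}{\sigma\beta\lambda},\quad C_3=\frac{\mu-L\sqrt2}{2}-\frac{16L^2}{\sigma\beta\lambda},\quad C_4=\frac1{\sigma\beta}.$$ With $B=\tau\,\mathrm{Id}-\beta A^TA$, $C_0=\frac{4(1-\sigma)}{\sigma^2\beta\lambda}$ and $C_1=\frac{8(\sigma\tau+L\sqrt2)^2}{\sigma\beta\lambda}$ define $$\Psi(x,y,z,u,x',u')=F(z)+G(y)+H(x,y)+\langle u,Ax-z\rangle+\tfrac\beta2\|Ax-z\|^2+C_0\|A^T(u-u')+\sigma B(x-x')\|^2+C_1\|x-x'\|^2,$$ and for $n\ge1$ put $X_n=(x_n,y_n,z_n,u_n,x_{n-1},u_{n-1})$,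 $\Psi_n=\Psi(X_n)$. **Łojasiewicz property.** Let $\partial\Psi$ be the limiting (Mordukhovich) subdifferential and $\operatorname{dist}(0,\emptyset)=+\infty$. We say that the Łojasiewicz inequality holds at a point $w$ with constant $C_L>0$ and exponent $\theta\in[0,1)$ if there is $\varepsilon>0$ such that $$|\Psi(v)-\Psi(w)|^\theta\le C_L\,\operatorname{dist}(0,\partial\Psi(v))\quad\text{for all } v \text{ with } \|v-w\|<\varepsilon,$$ with the convention $0^0=0$. Suppose that $\Psi$ has the Łojasiewicz property: at every $w$ with $0\in\partial\Psi(w)$ the Łojasiewicz inequality holds with some $C_L>0$ and some $\theta\in[0,1)$, which may depend on $w$. **Theorem.** The sequence $(X_n)$ converges to a point $X_*$, and $(\Psi_n)$ converges to a real number $\Psi_*=\Psi(X_*)$. If the Łojasiewicz inequality holds at $X_*$ with constant $C_L>0$ and exponent $\theta\in[0,1)$, then: 1. if $\theta=0$, there is $n_0\ge1$ such that $\Psi_n=\Psi_*$ for all $n\ge n_0$; 2. if $\theta\in(0,1/2]$, there are $n_0\ge1$, $\widehat C_0>0$ and $Q\in[0,1)$ such that $0\le\Psi_n-\Psi_*\le\widehat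 C_0Q^n$ for all $n\ge n_0$; 3. if $\theta\in(1/2,1)$, there are $n_0\ge1$ and $\widehat C_1>0$ such that $0\le\Psi_n-\Psi_*\le\widehat C_1n^{-1/(2\theta-1)}$ for all $n\ge n_0+1$. -/

import Mathlib

open Filter Topology

noncomputable section

/-- The Euclidean space of dimension `d`. -/
abbrev Euc (d : ℕ) : Type := EuclideanSpace ℝ (Fin d)

/-! ## Extended real valued functions and their subdifferentials -/

section Subdifferential

variable {E : Type*} [NormedAddCommGroup E] [InnerProductSpace ℝ E]

/-- `f : E → ℝ ∪ {+∞}` is proper: it never takes the value `-∞` and is not identically `+∞`. -/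
def IsProperFun {X : Type*} (f : X → EReal) : Prop :=
  (∀ x, f x ≠ ⊥) ∧ ∃ x, f x ≠ ⊤

/-- `f` is bounded from below by a real number. -/
def IsBddBelowFun {X : Type*} (f : X → EReal) : Prop :=
  ∃ c : ℝ, ∀ x, (c : EReal) ≤ f x

/-- The Fréchet (viscosity) subdifferential of `ψ` at `x`; empty if `ψ x = +∞`. -/
def frechetSubdiff (ψ : E → EReal) (x : E) : Set E :=
  {d | ψ x < ⊤ ∧
    0 ≤ liminf (fun y : E => (ψ y - ψ x - ((inner ℝ d (y - x) : ℝ) : EReal)) /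
      ((‖y - x‖ : ℝ) : EReal)) (𝓝[≠] x)}

/-- The limiting (Mordukhovich) subdifferential of `ψ` at `x`; empty if `ψ x = +∞`. -/
def limitingSubdiff (ψ : E → EReal) (x : E) : Set E :=
  {d | ψ x < ⊤ ∧ ∃ (xs ds : ℕ → E), Tendsto xs atTop (𝓝 x) ∧ Tendsto ds atTop (𝓝 d) ∧
    Tendsto (fun n => ψ (xs n)) atTop (𝓝 (ψ x)) ∧ ∀ n, ds n ∈ frechetSubdiff ψ (xs n)}

/-- The critical points of `ψ`. -/
def critSet (ψ : E → EReal) : Set E := {x | 0 ∈ limitingSubdiff ψ x}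

/-- The Łojasiewicz inequality of `ψ` at `w` with constant `C` and exponent `θ`:
`|ψ v - ψ w| ^ θ ≤ C * dist (0, ∂ψ v)` on some open ball around `w`. The distance to the empty set
is `+∞`. Points with `ψ v = ψ w` are left out: there the left-hand side is `0`,
for `θ = 0` by the usual convention `0 ^ 0 = 0` for this inequality. -/
def LojasiewiczAt (ψ : E → EReal) (w : E) (C θ : ℝ) : Prop :=
  ∃ ε : ℝ, 0 < ε ∧ ∀ v ∈ Metric.ball w ε, ψ v ≠ ψ w →
    (ψ v - ψ w).abs ^ θ ≤ ENNReal.ofReal C * Metric.infEDist 0 (limitingSubdiff ψ v)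

/-- The Łojasiewicz property: at every critical point the Łojasiewicz inequality holds with some
constant and some exponent, which may depend on the critical point. -/
def HasLojasiewiczProperty (ψ : E → EReal) : Prop :=
  ∀ w ∈ critSet ψ, ∃ C θ : ℝ, 0 < C ∧ 0 ≤ θ ∧ θ < 1 ∧ LojasiewiczAt ψ w C θ

end Subdifferential

/-! ## The problem, the algorithm and the regularized augmented Lagrangian -/

/-- The smallest eigenvalue of `A Aᵀ`. -/
def lamMin {m p : ℕ} (A : Euc m →L[ℝ] Euc p) : ℝ :=
  sInf {l : ℝ | Module.End.HasEigenvalue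
    ((A ∘L ContinuousLinearMap.adjoint A : Euc p →L[ℝ] Euc p) : Euc p →ₗ[ℝ] Euc p) l}

/-- The data: the functions `F`, `G`, `H` and the operator `A` of the problem
`min F (A x) + G y + H (x, y)`, the parameters `μ, β, τ, σ` of the algorithm, and the Lipschitz
modulus `L` that enters the constants of the regularized augmented Lagrangian. -/
structure SplitData (m q p : ℕ) where
  F : Euc p → EReal
  G : Euc q → EReal
  H : Euc m → Euc q → ℝ
  A : Euc m →L[ℝ] Euc p
  μ : ℝ
  β : ℝ
  τ : ℝ
  σ : ℝ
  L : ℝ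

/-- The product `ℝ^m × ℝ^q × ℝ^p × ℝ^p × ℝ^m × ℝ^p` with its Euclidean norm; points are
`(x, y, z, u, x', u')`. -/
abbrev BigSpace (m q p : ℕ) : Type :=
  WithLp 2 (Euc m × WithLp 2 (Euc q × WithLp 2 (Euc p × WithLp 2 (Euc p ×
    WithLp 2 (Euc m × Euc p)))))

/-- The point `(x, y, z, u, x', u')` of the big product space. -/
def bigPoint {m q p : ℕ} (x : Euc m) (y : Euc q) (z u : Euc p) (x' : Euc m) (u' : Euc p) :
    BigSpace m q p :=
  WithLp.toLp 2 (x, WithLp.toLp 2 (y, WithLp.toLp 2 (z, WithLp.toLp 2 (u,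
    WithLp.toLp 2 (x', u')))))

namespace SplitData

variable {m q p : ℕ} (D : SplitData m q p)

/-- The transpose of `A`. -/
def At : Euc p →L[ℝ] Euc m := ContinuousLinearMap.adjoint D.A

/-- The partial gradient of `H` in the first variable. -/
def gradX (x : Euc m) (y : Euc q) : Euc m := gradient (fun x' => D.H x' y) x

/-- The partial gradient of `H` in the second variable. -/
def gradY (x : Euc m) (y : Euc q) : Euc q := gradient (fun y' => D.H x y') y

/-- `B = τ Id - β Aᵀ A`. -/
def B : Euc m →L[ℝ] Euc m :=
  D.τ • ContinuousLinearMap.id ℝ (Euc m) - D.β • (D.At ∘L D.A)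

def C₀ : ℝ := 4 * (1 - D.σ) / (D.σ ^ 2 * D.β * lamMin D.A)

def C₁ : ℝ := 8 * (D.σ * D.τ + D.L * √2) ^ 2 / (D.σ * D.β * lamMin D.A)

def C₂ : ℝ :=
  D.τ - (D.L * √2 + D.β * ‖D.A‖ ^ 2) / 2 - 4 * D.σ * D.τ ^ 2 / (D.β * lamMin D.A)
    - 8 * (D.σ * D.τ + D.L * √2) ^ 2 / (D.σ * D.β * lamMin D.A)

def C₃ : ℝ :=
  (D.μ - D.L * √2) / 2 - 16 * D.L ^ 2 / (D.σ * D.β * lamMin D.A)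

def C₄ : ℝ := 1 / (D.σ * D.β)

/-- The regularized augmented Lagrangian as a function of its six arguments. -/
def lagr (x : Euc m) (y : Euc q) (z u : Euc p) (x' : Euc m) (u' : Euc p) : EReal :=
  D.F z + D.G y +
    ((D.H x y + inner ℝ u (D.A x - z) + D.β / 2 * ‖D.A x - z‖ ^ 2
      + D.C₀ * ‖D.At (u - u') + D.σ • D.B (x - x')‖ ^ 2 + D.C₁ * ‖x - x'‖ ^ 2 : ℝ) : EReal)

/-- The regularized augmented Lagrangian `Ψ` on the product space. -/
def Psi (X : BigSpace m q p) : EReal :=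
  D.lagr X.fst X.snd.fst X.snd.snd.fst X.snd.snd.snd.fst X.snd.snd.snd.snd.fst
    X.snd.snd.snd.snd.snd

/-- The standing assumptions on the functions, the operator and the parameters. -/
structure Standing : Prop where
  F_proper : IsProperFun D.F
  F_lsc : LowerSemicontinuous D.F
  F_bdd : IsBddBelowFun D.F
  G_proper : IsProperFun D.G
  G_lsc : LowerSemicontinuous D.G
  G_bdd : IsBddBelowFun D.G
  H_diff : Differentiable ℝ (fun w : Euc m × Euc q => D.H w.1 w.2)
  H_bdd : ∃ c : ℝ, ∀ x y, c ≤ D.H x y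
  A_surj : Function.Surjective D.A
  μ_pos : 0 < D.μ
  β_pos : 0 < D.β
  τ_pos : 0 < D.τ
  σ_pos : 0 < D.σ
  σ_le : D.σ ≤ 1
  L_pos : 0 < D.L
  two_τ : D.β * ‖D.A‖ ^ 2 ≤ 2 * D.τ
  C_pos : 0 < min D.C₂ (min D.C₃ D.C₄)

/-- `(x n, y n, z n, u n)` is a sequence generated by the algorithm. -/
structure Generates (x : ℕ → Euc m) (y : ℕ → Euc q) (z u : ℕ → Euc p) : Prop where
  y_step : ∀ n, IsMinOn (fun v : Euc q => D.G v +
    ((inner ℝ (D.gradY (x n) (y n)) v + D.μ / 2 * ‖v - y n‖ ^ 2 : ℝ) : EReal))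
    Set.univ (y (n + 1))
  z_step : ∀ n, IsMinOn (fun v : Euc p => D.F v +
    ((inner ℝ (u n) (D.A (x n) - v) + D.β / 2 * ‖D.A (x n) - v‖ ^ 2 : ℝ) : EReal))
    Set.univ (z (n + 1))
  x_step : ∀ n, x (n + 1) = x n - D.τ⁻¹ • (D.gradX (x n) (y (n + 1)) + D.At (u n)
    + D.β • D.At (D.A (x n) - z (n + 1)))
  u_step : ∀ n, u (n + 1) = u n + (D.σ * D.β) • (D.A (x (n + 1)) - z (n + 1))

/-- `∇H` is Lipschitz continuous with modulus `L` on `B₁ × B₂`, for the Euclidean norms. -/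
def GradLipschitzOn (B₁ : Set (Euc m)) (B₂ : Set (Euc q)) : Prop :=
  ∀ x ∈ B₁, ∀ y ∈ B₂, ∀ x' ∈ B₁, ∀ y' ∈ B₂,
    √(‖D.gradX x y - D.gradX x' y'‖ ^ 2 + ‖D.gradY x y - D.gradY x' y'‖ ^ 2) ≤
      D.L * √(‖x - x'‖ ^ 2 + ‖y - y'‖ ^ 2)

end SplitData

/-- `X_n = (x_n, y_n, z_n, u_n, x_{n-1}, u_{n-1})`, meaningful for `n ≥ 1`. -/
def bigSeq {m q p : ℕ} (x : ℕ → Euc m) (y : ℕ → Euc q) (z u : ℕ → Euc p) (n : ℕ) :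
    BigSpace m q p :=
  bigPoint (x n) (y n) (z n) (u n) (x (n - 1)) (u (n - 1))

end

noncomputable section

/-! The function Ψ is a Lyapunov function. Write Δ for the increment of one step and s_n for the sum
of the norms of the steps in x, y, u that lead to the n-th iterate. For n ≥ 1 there are constants c,
K > 0 with c s_{n+1}² ≤ Ψ_n - Ψ_{n+1} (`psiVal_descent`) and an element of ∂Ψ(X_n) of norm at most K
s_n (`exists_subgradient_bound`).

Descent: the y, z and x steps control the augmented Lagrangian from above, but the dual step adds
‖Δu‖²/(σβ). Since A is surjective, λ > 0 and ‖Δu‖ is controlled by ‖AᵀΔu‖. The vector w = AᵀΔu +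
σBΔx obeys a recursion with factor 1 - σ and a remainder governed by Δx and Δy; convexity of the
squared norm turns it into a telescoping difference, which the C₀ and C₁ terms of Ψ absorb.

Subgradients: minimality in the y and z steps yields smooth minorants of G and F that touch at the
new iterate. Hence Ψ has a smooth minorant touching at X_{n+1}, whose gradient is a Fréchet
subgradient; no sum rule is needed.

Convergence: Ψ_n decreases to some Ψ_*, and every cluster point of the bounded sequence is critical
with value Ψ_*. A compactness argument (`exists_lojasiewicz`) gives one Łojasiewicz inequality on a
tail of the sequence, so s is summable (`summable_of_descent_of_lojasiewicz`); x, y, u converge, and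
z follows from the dual step. With E_n = Ψ_n - Ψ_*, squaring the inequality at the limit gives
E_{n+1}^{2θ} ≤ M (E_n - E_{n+1}) whenever E_{n+1} ≠ 0, and the three rates are read off from this
recursion. -/

/-! ### Fréchet subgradients from smooth minorants, and the descent lemma -/

theorem mem_frechetSubdiff_of_minorant {E : Type*} [NormedAddCommGroup E] [InnerProductSpace ℝ E]
    {ψ : E → EReal} {Φ : E → ℝ} {x d : E} (hd : HasFDerivAt Φ (innerSL ℝ d) x)
    (hx : ψ x = Φ x) (hle : ∀ y, (Φ y : EReal) ≤ ψ y) : d ∈ frechetSubdiff ψ x := by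
  refine ⟨hx ▸ EReal.coe_lt_top _, ?_⟩
  refine le_of_forall_lt fun c hc => ?_
  obtain ⟨r, hcr, hr0⟩ := EReal.lt_iff_exists_real_btwn.1 hc
  have hr0 : r < 0 := by exact_mod_cast hr0
  refine hcr.trans_le (le_liminf_of_le (by isBoundedDefault) ?_)
  -- The little-o bound with constant -r > 0 keeps the difference quotient of Φ, hence that of ψ,
  -- above r near x.
  have h := (hasFDerivAt_iff_isLittleO.1 hd).def (c := -r) (by linarith)
  filter_upwards [h.filter_mono nhdsWithin_le_nhds, self_mem_nhdsWithin] with y hy hyx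
  have hpos : 0 < ‖y - x‖ := norm_pos_iff.2 (sub_ne_zero.2 hyx)
  have h1 : r * ‖y - x‖ ≤ Φ y - Φ x - inner ℝ d (y - x) := by
    have := (abs_le.1 hy).1
    simp only [innerSL_apply_apply] at this
    linarith
  have h2 : ((Φ y - Φ x - inner ℝ d (y - x) : ℝ) : EReal) ≤
      ψ y - ψ x - ((inner ℝ d (y - x) : ℝ) : EReal) := by
    rw [hx]
    push_cast
    exact EReal.sub_le_sub (EReal.sub_le_sub (hle y) le_rfl) le_rfl
  rw [EReal.le_div_iff_mul_le (by exact_mod_cast hpos) (EReal.coe_ne_top _)]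
  refine le_trans ?_ h2
  exact_mod_cast h1

theorem frechetSubdiff_subset_limitingSubdiff {E : Type*} [NormedAddCommGroup E]
    [InnerProductSpace ℝ E] (ψ : E → EReal) (x : E) :
    frechetSubdiff ψ x ⊆ limitingSubdiff ψ x := fun d hd =>
  ⟨hd.1, fun _ => x, fun _ => d, tendsto_const_nhds, tendsto_const_nhds, tendsto_const_nhds,
    fun _ => hd⟩

/-- The descent lemma along a segment on which the gradient is Lipschitz. -/
theorem le_add_inner_gradient_add_sq {E : Type*} [NormedAddCommGroup E] [InnerProductSpace ℝ E]
    [CompleteSpace E] {f : E → ℝ} (hf : Differentiable ℝ f) {s : Set E} (hs : Convex ℝ s) {K : ℝ}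
    (hK : ∀ a ∈ s, ∀ b ∈ s, ‖gradient f a - gradient f b‖ ≤ K * ‖a - b‖) {a b : E}
    (ha : a ∈ s) (hb : b ∈ s) :
    f b ≤ f a + inner ℝ (gradient f a) (b - a) + K / 2 * ‖b - a‖ ^ 2 := by
  set v := b - a with hv
  -- The claim is g 1 ≤ g 0; the Lipschitz bound between a + t v and a makes the derivative of g
  -- nonpositive.
  let g : ℝ → ℝ := fun t => f (a + t • v) - t * inner ℝ (gradient f a) v - K / 2 * t ^ 2 * ‖v‖ ^ 2
  have hg : ∀ t, HasDerivAt g (inner ℝ (gradient f (a + t • v)) v - inner ℝ (gradient f a) v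
      - K * t * ‖v‖ ^ 2) t := by
    intro t
    have h1 : HasDerivAt (fun t : ℝ => a + t • v) v t := by
      simpa using ((hasDerivAt_id t).smul_const v).const_add a
    have h2 : HasDerivAt (fun t : ℝ => f (a + t • v)) (inner ℝ (gradient f (a + t • v)) v) t := by
      have := (hf (a + t • v)).hasGradientAt.hasFDerivAt.comp_hasDerivAt t h1
      simpa [Function.comp_def] using this
    have h3 : HasDerivAt (fun t : ℝ => t * inner ℝ (gradient f a) v)
        (inner ℝ (gradient f a) v) t := by
      simpa using (hasDerivAt_id t).mul_const (inner ℝ (gradient f a) v)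
    have h4 : HasDerivAt (fun t : ℝ => K / 2 * t ^ 2 * ‖v‖ ^ 2) (K * t * ‖v‖ ^ 2) t := by
      have := ((hasDerivAt_pow 2 t).const_mul (K / 2)).mul_const (‖v‖ ^ 2)
      exact this.congr_deriv (by push_cast; ring)
    exact (h2.sub h3).sub h4
  have hanti : AntitoneOn g (Set.Icc 0 1) := by
    refine antitoneOn_of_deriv_nonpos (convex_Icc 0 1)
      (fun t _ => (hg t).continuousAt.continuousWithinAt)
      (fun t _ => (hg t).differentiableAt.differentiableWithinAt) fun t ht => ?_
    rw [interior_Icc] at ht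
    rw [(hg t).deriv, ← inner_sub_left]
    have hmem : a + t • v ∈ s := hs.add_smul_sub_mem ha hb ⟨ht.1.le, ht.2.le⟩
    have h5 := hK _ hmem _ ha
    have h6 : ‖a + t • v - a‖ = t * ‖v‖ := by
      rw [add_sub_cancel_left, norm_smul, Real.norm_of_nonneg ht.1.le]
    rw [h6] at h5
    have h7 := real_inner_le_norm (gradient f (a + t • v) - gradient f a) v
    have h8 := mul_le_mul_of_nonneg_right h5 (norm_nonneg v)
    nlinarith
  have h := hanti (Set.left_mem_Icc.2 zero_le_one) (Set.right_mem_Icc.2 zero_le_one) zero_le_one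
  have e1 : a + v = b := by rw [hv]; abel
  simp only [g, one_smul, zero_smul, add_zero, e1] at h
  linarith

/-! ### The smallest eigenvalue of `A Aᵀ` -/

section LamMin

variable {m p : ℕ}

theorem inner_comp_adjoint_self (A : Euc m →L[ℝ] Euc p) (u : Euc p) :
    inner ℝ (A (ContinuousLinearMap.adjoint A u)) u = ‖ContinuousLinearMap.adjoint A u‖ ^ 2 := by
  rw [← ContinuousLinearMap.adjoint_inner_right, real_inner_self_eq_norm_sq]

theorem adjoint_injective_of_surjective {A : Euc m →L[ℝ] Euc p} (hA : Function.Surjective A) :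
    Function.Injective (ContinuousLinearMap.adjoint A) := by
  rw [injective_iff_map_eq_zero]
  intro u hu
  obtain ⟨v, rfl⟩ := hA u
  have := ContinuousLinearMap.adjoint_inner_right A v (A v)
  rw [hu, inner_zero_right] at this
  exact inner_self_eq_zero.1 this.symm

/-- The infimum is that of the Rayleigh quotient of the symmetric operator A Aᵀ. It is attained at
an eigenvector, and each eigenvalue is itself a value of the quotient. Positivity of p is needed for
a nonzero vector to exist. -/
theorem isLeast_eigenvalue_comp_adjoint (hp : 0 < p) (A : Euc m →L[ℝ] Euc p) :
    IsLeast {l : ℝ | Module.End.HasEigenvalue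
      ((A ∘L ContinuousLinearMap.adjoint A : Euc p →L[ℝ] Euc p) : Euc p →ₗ[ℝ] Euc p) l}
      (⨅ u : {u : Euc p // u ≠ 0}, ‖ContinuousLinearMap.adjoint A u‖ ^ 2 / ‖(u : Euc p)‖ ^ 2) := by
  have : Nonempty (Fin p) := ⟨⟨0, hp⟩⟩
  have : Nontrivial (Euc p) := inferInstance
  set T : Euc p →ₗ[ℝ] Euc p :=
    ((A ∘L ContinuousLinearMap.adjoint A : Euc p →L[ℝ] Euc p) : Euc p →ₗ[ℝ] Euc p) with hTdef
  have hTa : ∀ u, inner ℝ (T u) u = ‖ContinuousLinearMap.adjoint A u‖ ^ 2 := fun u =>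
    inner_comp_adjoint_self A u
  have hT : T.IsSymmetric := by
    intro u v
    change inner ℝ (A (ContinuousLinearMap.adjoint A u)) v =
      inner ℝ u (A (ContinuousLinearMap.adjoint A v))
    rw [← ContinuousLinearMap.adjoint_inner_right,
      ← ContinuousLinearMap.adjoint_inner_left A (ContinuousLinearMap.adjoint A v) u]
  constructor
  · have := hT.hasEigenvalue_iInf_of_finiteDimensional
    simp only [hTa] at this
    exact this
  · intro l hl
    obtain ⟨v, hv⟩ := hl.exists_hasEigenvector
    have h1 := hTa v
    rw [hv.apply_eq_smul, real_inner_smul_left, real_inner_self_eq_norm_sq] at h1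
    have hv0 : 0 < ‖v‖ := norm_pos_iff.2 hv.2
    have h2 : l = ‖ContinuousLinearMap.adjoint A v‖ ^ 2 / ‖v‖ ^ 2 := by
      rw [← h1]; field_simp
    rw [h2]
    exact ciInf_le ⟨0, by rintro _ ⟨u, rfl⟩; positivity⟩ (⟨v, hv.2⟩ : {u : Euc p // u ≠ 0})

theorem lamMin_mul_sq_le (hp : 0 < p) (A : Euc m →L[ℝ] Euc p) (u : Euc p) :
    lamMin A * ‖u‖ ^ 2 ≤ ‖ContinuousLinearMap.adjoint A u‖ ^ 2 := by
  rw [lamMin, (isLeast_eigenvalue_comp_adjoint hp A).csInf_eq]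
  rcases eq_or_ne u 0 with rfl | hu
  · simp
  · have hu0 : 0 < ‖u‖ := norm_pos_iff.2 hu
    rw [← le_div_iff₀ (by positivity)]
    exact ciInf_le ⟨0, by rintro _ ⟨u, rfl⟩; positivity⟩ (⟨u, hu⟩ : {u : Euc p // u ≠ 0})

theorem lamMin_pos (hp : 0 < p) {A : Euc m →L[ℝ] Euc p} (hA : Function.Surjective A) :
    0 < lamMin A := by
  have h := isLeast_eigenvalue_comp_adjoint hp A
  have hl : lamMin A = _ := h.csInf_eq
  obtain ⟨v, hv⟩ := (hl ▸ h.1 : Module.End.HasEigenvalue _ (lamMin A)).exists_hasEigenvector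
  have h1 := inner_comp_adjoint_self A v
  have h2 : A (ContinuousLinearMap.adjoint A v) = lamMin A • v := hv.apply_eq_smul
  rw [h2, real_inner_smul_left, real_inner_self_eq_norm_sq] at h1
  have hv0 : 0 < ‖v‖ := norm_pos_iff.2 hv.2
  have h3 : 0 < ‖ContinuousLinearMap.adjoint A v‖ := norm_pos_iff.2 fun h0 =>
    hv.2 (adjoint_injective_of_surjective hA (by rw [h0, map_zero]))
  by_contra hneg
  have : lamMin A * ‖v‖ ^ 2 ≤ 0 := mul_nonpos_of_nonpos_of_nonneg (not_lt.1 hneg) (by positivity)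
  have : 0 < ‖ContinuousLinearMap.adjoint A v‖ ^ 2 := by positivity
  linarith

end LamMin

/-! ### Values of lower semicontinuous functions along almost minimizing sequences -/

/-- Semicontinuity bounds the values from below and almost minimality from above. The value F a = +∞
is allowed. -/
theorem tendsto_of_lowerSemicontinuousAt_of_le {E : Type*} [TopologicalSpace E] {F : E → EReal}
    {a : E} (hF : LowerSemicontinuousAt F a) {v : ℕ → E} (hv : Tendsto v atTop (𝓝 a)) {r : ℕ → ℝ}
    (hr : Tendsto r atTop (𝓝 0)) (hle : ∀ᶠ k in atTop, F (v k) ≤ F a + r k) :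
    Tendsto (fun k => F (v k)) atTop (𝓝 (F a)) := by
  refine tendsto_order.2 ⟨fun b hb => hv.eventually (hF b hb), fun b hb => ?_⟩
  have h1 : Tendsto (fun k => F a + (r k : EReal)) atTop (𝓝 (F a + ((0 : ℝ) : EReal))) :=
    (EReal.continuousAt_add (p := (F a, ((0 : ℝ) : EReal))) (by simp) (by simp)).tendsto.comp
      (tendsto_const_nhds.prodMk_nhds ((continuous_coe_real_ereal.tendsto 0).comp hr))
  rw [EReal.coe_zero, add_zero] at h1
  filter_upwards [hle, h1.eventually (gt_mem_nhds hb)] with k hk hk'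
  exact hk.trans_lt hk'

/-! ### Descent sequences with a Łojasiewicz inequality -/

/-- Concavity of t ↦ t^(1-θ) combines descent and the Łojasiewicz inequality into s_{n+1}² ≤ s_n · K
P, where P is the decrease of E^(1-θ). Then 2 s_{n+1} ≤ s_n + K P by the arithmetic-geometric mean
inequality, and this telescopes. -/
theorem summable_of_descent_of_lojasiewicz {E s : ℕ → ℝ} {c M θ : ℝ} {N : ℕ} (hc : 0 < c)
    (hM : 0 ≤ M) (hθ0 : 0 ≤ θ) (hθ1 : θ < 1) (hE : ∀ n, N ≤ n → 0 ≤ E n) (hs : ∀ n, 0 ≤ s n)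
    (hdesc : ∀ n, N ≤ n → c * s (n + 1) ^ 2 ≤ E n - E (n + 1))
    (hloj : ∀ n, N ≤ n → E n ≠ 0 → E n ^ θ ≤ M * s n) : Summable s := by
  set K := M / (c * (1 - θ)) with hK
  have h1θ : 0 < 1 - θ := by linarith
  have hK0 : 0 ≤ K := by positivity
  have key : ∀ n, N ≤ n → s (n + 1) ≤
      (s n + K * E n ^ (1 - θ)) - (s (n + 1) + K * E (n + 1) ^ (1 - θ)) := by
    intro n hn
    have hE0 := hE n hn
    have hE1 := hE (n + 1) (hn.trans n.le_succ)
    have hd := hdesc n hn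
    have hs0 := hs n
    have hs1 := hs (n + 1)
    -- The inequality is not assumed where E n = 0, since `0 ^ 0 = 1` for real powers; there descent
    -- alone forces s (n + 1) = 0.
    rcases eq_or_ne (E n) 0 with h0 | h0
    · have h2 : c * s (n + 1) ^ 2 ≤ 0 := by linarith
      have h3 : s (n + 1) ^ 2 ≤ 0 := by
        by_contra h
        have := mul_pos hc (not_le.1 h)
        linarith
      have h4 : s (n + 1) = 0 := pow_eq_zero_iff (two_ne_zero) |>.1 (le_antisymm h3 (sq_nonneg _))
      have h5 : E (n + 1) = 0 := by
        rw [h4] at hd; linarith [mul_nonneg hc.le (sq_nonneg (0 : ℝ))]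
      rw [h0, h5, h4]; linarith
    · have hEp : 0 < E n := lt_of_le_of_ne hE0 (Ne.symm h0)
      -- Concavity in the form E_n^θ E_{n+1}^(1-θ) ≤ θ E_n + (1-θ) E_{n+1}.
      have h2 := Real.geom_mean_le_arith_mean2_weighted hθ0 h1θ.le hE0 hE1 (by ring)
      have h3 : E n ^ θ * E n ^ (1 - θ) = E n := by
        rw [← Real.rpow_add hEp]; simp
      have hmono : E (n + 1) ^ (1 - θ) ≤ E n ^ (1 - θ) :=
        Real.rpow_le_rpow hE1 (by nlinarith [sq_nonneg (s (n + 1))]) h1θ.le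
      have h4 : E n ^ θ * (E n ^ (1 - θ) - E (n + 1) ^ (1 - θ)) ≤
          M * s n * (E n ^ (1 - θ) - E (n + 1) ^ (1 - θ)) :=
        mul_le_mul_of_nonneg_right (hloj n hn h0) (by linarith)
      set P := E n ^ (1 - θ) - E (n + 1) ^ (1 - θ) with hP
      have h5 : (1 - θ) * (c * s (n + 1) ^ 2) ≤ M * s n * P := by
        calc (1 - θ) * (c * s (n + 1) ^ 2) ≤ (1 - θ) * (E n - E (n + 1)) :=
              mul_le_mul_of_nonneg_left hd h1θ.le
          _ ≤ E n ^ θ * P := by rw [mul_sub (E n ^ θ), h3]; linarith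
          _ ≤ _ := h4
      have h6 : s (n + 1) ^ 2 ≤ s n * (K * P) := by
        have : s n * (K * P) = M * s n * P / (c * (1 - θ)) := by rw [hK]; ring
        rw [this, le_div_iff₀ (by positivity)]
        linarith
      have hKP : 0 ≤ K * P := mul_nonneg hK0 (by linarith)
      have h7 : (2 * s (n + 1)) ^ 2 ≤ (s n + K * P) ^ 2 := by nlinarith [sq_nonneg (s n - K * P)]
      have h8 := abs_le_of_sq_le_sq' h7 (by positivity)
      have h9 : K * P = K * E n ^ (1 - θ) - K * E (n + 1) ^ (1 - θ) := by rw [hP]; ring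
      linarith [h8.2]
  have hsum : Summable fun k => s (k + (N + 1)) := by
    refine summable_of_sum_range_le (c := s N + K * E N ^ (1 - θ)) (fun k => hs _) fun k => ?_
    have h : ∑ i ∈ Finset.range k, s (i + (N + 1)) ≤
        (s N + K * E N ^ (1 - θ)) - (s (N + k) + K * E (N + k) ^ (1 - θ)) := by
      induction k with
      | zero => simp
      | succ k ih =>
        rw [Finset.sum_range_succ]
        have := key (N + k) (Nat.le_add_right _ _)
        have e : k + (N + 1) = N + k + 1 := by ring
        rw [e]
        change _ ≤ (s N + K * E N ^ (1 - θ)) - (s (N + k + 1) + K * E (N + k + 1) ^ (1 - θ))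
        linarith
    have h2 : 0 ≤ K * E (N + k) ^ (1 - θ) :=
      mul_nonneg hK0 (Real.rpow_nonneg (hE _ (Nat.le_add_right _ _)) _)
    linarith [hs (N + k)]
  exact (summable_nat_add_iff (N + 1)).1 hsum

theorem eventually_eq_zero_of_descent {E : ℕ → ℝ} {M : ℝ} (hlim : Tendsto E atTop (𝓝 0))
    (h : ∀ᶠ n in atTop, E (n + 1) ≠ 0 → 1 ≤ M * (E n - E (n + 1))) :
    ∀ᶠ n in atTop, E n = 0 := by
  have h1 : Tendsto (fun n => M * (E n - E (n + 1))) atTop (𝓝 0) := by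
    simpa using (hlim.sub (hlim.comp (tendsto_add_atTop_nat 1))).const_mul M
  rw [← map_add_atTop_eq_nat 1, eventually_map]
  filter_upwards [h, h1.eventually (gt_mem_nhds one_pos)] with n hn hn'
  by_contra h0
  linarith [hn h0]

theorem linear_rate_of_descent {E : ℕ → ℝ} {M : ℝ} {N : ℕ} (hM : 0 < M)
    (hE : ∀ n, N ≤ n → 0 ≤ E n) (h : ∀ n, N ≤ n → E (n + 1) ≤ M * (E n - E (n + 1))) :
    ∃ C Q : ℝ, 0 < C ∧ 0 ≤ Q ∧ Q < 1 ∧ ∀ n, N ≤ n → E n ≤ C * Q ^ n := by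
  set Q := M / (1 + M) with hQ
  have hQ0 : 0 < Q := by positivity
  have hstep : ∀ n, N ≤ n → E (n + 1) ≤ Q * E n := by
    intro n hn
    rw [hQ, div_mul_eq_mul_div, le_div_iff₀ (by positivity)]
    linarith [h n hn]
  -- The summand 1 only keeps the constant positive when E N = 0.
  refine ⟨(E N + 1) / Q ^ N, Q, ?_, hQ0.le, (div_lt_one (by positivity)).2 (by linarith),
    fun n hn => ?_⟩
  · have := hE N le_rfl
    positivity
  · induction n, hn using Nat.le_induction with
    | base => rw [div_mul_cancel₀ _ (by positivity)]; linarith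
    | succ n hn ih =>
      calc E (n + 1) ≤ Q * E n := hstep n hn
        _ ≤ Q * ((E N + 1) / Q ^ N * Q ^ n) := mul_le_mul_of_nonneg_left ih hQ0.le
        _ = _ := by ring

theorem one_add_rpow_le {r t : ℝ} (hr : 1 ≤ r) (h0 : 0 ≤ t) (h1 : t ≤ 1) :
    (1 + t) ^ r ≤ 1 + 2 ^ r * t := by
  have h := (convexOn_rpow hr).2 (Set.mem_Ici.2 zero_le_one) (Set.mem_Ici.2 zero_le_two)
    (sub_nonneg.2 h1) h0 (sub_add_cancel 1 t)
  simp only [smul_eq_mul, Real.one_rpow] at h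
  have e : (1 - t) * 1 + t * 2 = 1 + t := by ring
  rw [e] at h
  linarith

/-- Induction against the barrier C n^(-r), r = 1/a: were E (n + 1) above it, E^(1+a) at n + 1 would
exceed the drop from n to n + 1 permitted by the induction hypothesis, because (1 + 1/n)^r ≤ 1 + 2^r
/ n. -/
theorem sublinear_rate_of_descent {E : ℕ → ℝ} {M a : ℝ} {N : ℕ} (hN : 1 ≤ N) (hM : 0 < M)
    (ha : 0 < a) (ha1 : a < 1) (hE : ∀ n, N ≤ n → 0 ≤ E n)
    (h : ∀ n, N ≤ n → E (n + 1) ^ (1 + a) ≤ M * (E n - E (n + 1))) :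
    ∃ C : ℝ, 0 < C ∧ ∀ n, N ≤ n → E n ≤ C * (n : ℝ) ^ (-(1 / a)) := by
  set r := 1 / a with hr
  have hr1 : 1 ≤ r := by rw [hr, le_div_iff₀ ha]; linarith
  have hNp : (0 : ℝ) < N := by exact_mod_cast hN
  have hEN := hE N le_rfl
  -- The first summand gives C^a ≥ 2 M 2^r for the induction step, the second the base case.
  set C := (2 * M * 2 ^ r) ^ r + E N * (N : ℝ) ^ r with hC
  have hB : 0 < 2 * M * (2 : ℝ) ^ r := by positivity
  have hC0 : 0 < C := by positivity
  have hCa : 2 * M * 2 ^ r ≤ C ^ a := by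
    calc 2 * M * (2 : ℝ) ^ r = ((2 * M * 2 ^ r) ^ r) ^ a := by
          rw [← Real.rpow_mul hB.le, hr, one_div_mul_cancel ha.ne', Real.rpow_one]
      _ ≤ C ^ a := Real.rpow_le_rpow (by positivity) (by rw [hC]; linarith [mul_nonneg hEN (Real.rpow_nonneg hNp.le r)]) ha.le
  refine ⟨C, hC0, fun n hn => ?_⟩
  induction n, hn using Nat.le_induction with
  | base =>
    rw [Real.rpow_neg hNp.le, ← div_eq_mul_inv, le_div_iff₀ (by positivity), hC]
    linarith [Real.rpow_nonneg hB.le r]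
  | succ n hn ih =>
    by_contra hlt
    rw [not_le] at hlt
    have hnp : (0 : ℝ) < n := by exact_mod_cast hN.trans hn
    have hn1 : (1 : ℝ) ≤ n := by exact_mod_cast hN.trans hn
    have hn1p : (0 : ℝ) < ((n + 1 : ℕ) : ℝ) := by positivity
    set X := C * ((n + 1 : ℕ) : ℝ) ^ (-r) with hX
    have hX0 : 0 < X := by positivity
    have hXpow : X ^ (1 + a) = X * (C ^ a / (n + 1)) := by
      rw [Real.rpow_add hX0, Real.rpow_one, hX, Real.mul_rpow hC0.le (by positivity),
        ← Real.rpow_mul hn1p.le]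
      have : -r * a = -1 := by rw [hr]; field_simp
      rw [this, Real.rpow_neg_one]
      push_cast
      ring
    have h1 : X ^ (1 + a) ≤ E (n + 1) ^ (1 + a) := Real.rpow_le_rpow hX0.le hlt.le (by linarith)
    have h2 := h n hn
    have h3 : C * (n : ℝ) ^ (-r) = X * (1 + 1 / n) ^ r := by
      have e : (1 + 1 / (n : ℝ)) = ((n + 1 : ℕ) : ℝ) / n := by push_cast; field_simp
      rw [e, Real.div_rpow hn1p.le hnp.le, hX, Real.rpow_neg hn1p.le, Real.rpow_neg hnp.le]
      field_simp
    have h4 := one_add_rpow_le hr1 (t := 1 / (n : ℝ)) (by positivity)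
      (by rw [div_le_one hnp]; exact hn1)
    have h5 : E n ≤ X * (1 + 2 ^ r * (1 / n)) := by
      rw [h3] at ih
      exact ih.trans (mul_le_mul_of_nonneg_left h4 hX0.le)
    have h6 : M * (2 ^ r * (1 / n)) ≤ C ^ a / (n + 1) := by
      rw [le_div_iff₀ (by positivity)]
      refine le_trans ?_ hCa
      have : M * (2 ^ r * (1 / n)) * ((n : ℝ) + 1) = M * 2 ^ r * ((n + 1) / n) := by ring
      rw [this]
      have h7 : ((n : ℝ) + 1) / n ≤ 2 := by rw [div_le_iff₀ hnp]; linarith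
      nlinarith [mul_le_mul_of_nonneg_left h7 (show 0 ≤ M * (2 : ℝ) ^ r by positivity)]
    have h8 : M * (E n - E (n + 1)) < M * (X * (2 ^ r * (1 / n))) :=
      mul_lt_mul_of_pos_left (by linarith) hM
    have h9 := mul_le_mul_of_nonneg_left h6 hX0.le
    rw [hXpow] at h1
    linarith

/-! ### Minimizers of `f + q` with `q` real valued -/

section Argmin

variable {X : Type*} {f : X → EReal} {q : X → ℝ} {a : X}

theorem IsMinOn.ne_top_of_isProperFun (hf : IsProperFun f)
    (ha : IsMinOn (fun v => f v + (q v : EReal)) Set.univ a) : f a ≠ ⊤ := by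
  obtain ⟨v, hv⟩ := hf.2
  intro h
  have h1 : f a + (q a : EReal) ≤ f v + (q v : EReal) := ha (Set.mem_univ v)
  rw [h, EReal.top_add_coe, top_le_iff] at h1
  exact (EReal.add_lt_top hv (EReal.coe_ne_top _)).ne h1

/-- Minimality read as a real-valued minorant of f that touches f at a; for smooth q this replaces
the first-order optimality condition. -/
theorem IsMinOn.coe_toReal_add_sub_le (hf : IsProperFun f)
    (ha : IsMinOn (fun v => f v + (q v : EReal)) Set.univ a) (v : X) :
    (((f a).toReal + q a - q v : ℝ) : EReal) ≤ f v := by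
  have h1 : f a + (q a : EReal) ≤ f v + (q v : EReal) := ha (Set.mem_univ v)
  have hfa := EReal.coe_toReal (ha.ne_top_of_isProperFun hf) (hf.1 a)
  rcases eq_or_ne (f v) ⊤ with h | h
  · simp [h]
  · rw [← hfa, ← EReal.coe_toReal h (hf.1 v)] at h1
    rw [← EReal.coe_toReal h (hf.1 v)]
    have h2 : (f a).toReal + q a ≤ (f v).toReal + q v := by exact_mod_cast h1
    exact_mod_cast (by linarith : (f a).toReal + q a - q v ≤ (f v).toReal)

theorem IsMinOn.le_add_coe_sub (hf : IsProperFun f)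
    (ha : IsMinOn (fun v => f v + (q v : EReal)) Set.univ a) (v : X) :
    f a ≤ f v + ((q v - q a : ℝ) : EReal) := by
  have h1 : f a + (q a : EReal) ≤ f v + (q v : EReal) := ha (Set.mem_univ v)
  have hfa := EReal.coe_toReal (ha.ne_top_of_isProperFun hf) (hf.1 a)
  rcases eq_or_ne (f v) ⊤ with h | h
  · rw [h, EReal.top_add_coe]
    exact le_top
  · rw [← hfa, ← EReal.coe_toReal h (hf.1 v)] at h1 ⊢
    have h2 : (f a).toReal + q a ≤ (f v).toReal + q v := by exact_mod_cast h1
    exact_mod_cast (by linarith : (f a).toReal ≤ (f v).toReal + (q v - q a))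

end Argmin

namespace SplitData

variable {m q p : ℕ} {D : SplitData m q p}

/-! ### The smooth coupling function -/

theorem hasFDerivAt_H (hH : Differentiable ℝ (fun w : Euc m × Euc q => D.H w.1 w.2))
    (x : Euc m) (y : Euc q) :
    HasFDerivAt (fun w : Euc m × Euc q => D.H w.1 w.2)
      ((innerSL ℝ (D.gradX x y)).comp (ContinuousLinearMap.fst ℝ (Euc m) (Euc q)) +
        (innerSL ℝ (D.gradY x y)).comp (ContinuousLinearMap.snd ℝ (Euc m) (Euc q))) (x, y) := by
  have h := (hH (x, y)).hasFDerivAt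
  set T := fderiv ℝ (fun w : Euc m × Euc q => D.H w.1 w.2) (x, y)
  have hx : HasFDerivAt (fun x' => D.H x' y) (T.comp (.inl ℝ (Euc m) (Euc q))) x :=
    HasFDerivAt.comp (g := fun w : Euc m × Euc q => D.H w.1 w.2) x h
      (hasFDerivAt_prodMk_left (𝕜 := ℝ) x y)
  have hy : HasFDerivAt (fun y' => D.H x y') (T.comp (.inr ℝ (Euc m) (Euc q))) y :=
    HasFDerivAt.comp (g := fun w : Euc m × Euc q => D.H w.1 w.2) y h
      (hasFDerivAt_prodMk_right (𝕜 := ℝ) x y)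
  have hx' := hx.differentiableAt.hasGradientAt.hasFDerivAt.unique hx
  have hy' := hy.differentiableAt.hasGradientAt.hasFDerivAt.unique hy
  convert h using 1
  ext v
  · have := congrArg (fun T => T v) hx'
    simpa [gradX] using this
  · have := congrArg (fun T => T v) hy'
    simpa [gradY] using this

theorem differentiable_H_left (hH : Differentiable ℝ (fun w : Euc m × Euc q => D.H w.1 w.2))
    (y : Euc q) : Differentiable ℝ fun x => D.H x y :=
  hH.comp (differentiable_id.prodMk (differentiable_const y))

theorem differentiable_H_right (hH : Differentiable ℝ (fun w : Euc m × Euc q => D.H w.1 w.2))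
    (x : Euc m) : Differentiable ℝ fun y => D.H x y :=
  hH.comp ((differentiable_const x).prodMk differentiable_id)

section Lipschitz

variable {B₁ : Set (Euc m)} {B₂ : Set (Euc q)} {x x' : Euc m} {y y' : Euc q}

theorem GradLipschitzOn.gradX_sub_le (h : D.GradLipschitzOn B₁ B₂) (hL : 0 ≤ D.L) (hx : x ∈ B₁)
    (hy : y ∈ B₂) (hx' : x' ∈ B₁) (hy' : y' ∈ B₂) :
    ‖D.gradX x y - D.gradX x' y'‖ ≤ D.L * (‖x - x'‖ + ‖y - y'‖) := by
  refine (Real.le_sqrt_of_sq_le (le_add_of_nonneg_right (sq_nonneg _))).trans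
    ((h x hx y hy x' hx' y' hy').trans (mul_le_mul_of_nonneg_left ?_ hL))
  rw [Real.sqrt_le_left (by positivity)]
  nlinarith [norm_nonneg (x - x'), norm_nonneg (y - y')]

theorem GradLipschitzOn.gradY_sub_le (h : D.GradLipschitzOn B₁ B₂) (hL : 0 ≤ D.L) (hx : x ∈ B₁)
    (hy : y ∈ B₂) (hx' : x' ∈ B₁) (hy' : y' ∈ B₂) :
    ‖D.gradY x y - D.gradY x' y'‖ ≤ D.L * (‖x - x'‖ + ‖y - y'‖) := by
  refine (Real.le_sqrt_of_sq_le (le_add_of_nonneg_left (sq_nonneg _))).trans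
    ((h x hx y hy x' hx' y' hy').trans (mul_le_mul_of_nonneg_left ?_ hL))
  rw [Real.sqrt_le_left (by positivity)]
  nlinarith [norm_nonneg (x - x'), norm_nonneg (y - y')]

end Lipschitz

/-! ### The linear operators -/

theorem inner_At (u : Euc p) (v : Euc m) : inner ℝ (D.At u) v = inner ℝ u (D.A v) :=
  ContinuousLinearMap.adjoint_inner_left D.A v u

theorem norm_At : ‖D.At‖ = ‖D.A‖ := ContinuousLinearMap.adjoint.norm_map D.A

theorem B_apply (v : Euc m) : D.B v = D.τ • v - D.β • D.At (D.A v) := by simp [B]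

/-- In the expansion of ‖τv - βAᵀAv‖² the last two terms are at most β‖Av‖²(β‖A‖² - 2τ) ≤ 0. -/
theorem norm_B_apply_le (hβ : 0 ≤ D.β) (hτ : 0 ≤ D.τ) (h2 : D.β * ‖D.A‖ ^ 2 ≤ 2 * D.τ)
    (v : Euc m) : ‖D.B v‖ ≤ D.τ * ‖v‖ := by
  refine abs_le_of_sq_le_sq' ?_ (by positivity) |>.2
  have h1 : inner ℝ v (D.At (D.A v)) = ‖D.A v‖ ^ 2 := by
    rw [real_inner_comm, inner_At, real_inner_self_eq_norm_sq]
  have h3 : ‖D.At (D.A v)‖ ^ 2 ≤ ‖D.A‖ ^ 2 * ‖D.A v‖ ^ 2 := by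
    rw [← mul_pow, ← norm_At]
    exact pow_le_pow_left₀ (norm_nonneg _) (D.At.le_opNorm _) 2
  rw [B_apply, norm_sub_sq_real, real_inner_smul_left, real_inner_smul_right, h1, norm_smul,
    norm_smul, Real.norm_of_nonneg hβ, Real.norm_of_nonneg hτ]
  have h4 := mul_le_mul_of_nonneg_left h3 (sq_nonneg D.β)
  have h5 : (D.β * ‖D.A v‖ ^ 2) * (D.β * ‖D.A‖ ^ 2) ≤ (D.β * ‖D.A v‖ ^ 2) * (2 * D.τ) :=
    mul_le_mul_of_nonneg_left h2 (by positivity)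
  nlinarith

/-! ### Descent of the regularized augmented Lagrangian -/

/-- The real valued part of the regularized augmented Lagrangian. -/
def smoothPart (D : SplitData m q p) (x : Euc m) (y : Euc q) (z u : Euc p) (x' : Euc m)
    (u' : Euc p) : ℝ :=
  D.H x y + inner ℝ u (D.A x - z) + D.β / 2 * ‖D.A x - z‖ ^ 2
    + D.C₀ * ‖D.At (u - u') + D.σ • D.B (x - x')‖ ^ 2 + D.C₁ * ‖x - x'‖ ^ 2

/-- The value of the regularized augmented Lagrangian along the algorithm, as a real number. -/
def psiVal (D : SplitData m q p) (x : ℕ → Euc m) (y : ℕ → Euc q) (z u : ℕ → Euc p) (n : ℕ) : ℝ :=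
  (D.F (z n)).toReal + (D.G (y n)).toReal +
    D.smoothPart (x n) (y n) (z n) (u n) (x (n - 1)) (u (n - 1))

variable {x : ℕ → Euc m} {y : ℕ → Euc q} {z u : ℕ → Euc p}

theorem Generates.F_ne_top (hgen : D.Generates x y z u) (hD : D.Standing) {n : ℕ} (hn : 1 ≤ n) :
    D.F (z n) ≠ ⊤ := by
  obtain ⟨n, rfl⟩ := Nat.exists_eq_add_of_le' hn
  exact (hgen.z_step n).ne_top_of_isProperFun hD.F_proper

theorem Generates.G_ne_top (hgen : D.Generates x y z u) (hD : D.Standing) {n : ℕ} (hn : 1 ≤ n) :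
    D.G (y n) ≠ ⊤ := by
  obtain ⟨n, rfl⟩ := Nat.exists_eq_add_of_le' hn
  exact (hgen.y_step n).ne_top_of_isProperFun hD.G_proper

theorem Generates.Psi_bigSeq (hgen : D.Generates x y z u) (hD : D.Standing) {n : ℕ}
    (hn : 1 ≤ n) : D.Psi (bigSeq x y z u n) = (D.psiVal x y z u n : EReal) := by
  change D.F (z n) + D.G (y n) + ((D.smoothPart (x n) (y n) (z n) (u n) (x (n - 1)) (u (n - 1)) :
    ℝ) : EReal) = _
  rw [psiVal, EReal.coe_add, EReal.coe_add, EReal.coe_toReal (hgen.F_ne_top hD hn)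
    (hD.F_proper.1 _), EReal.coe_toReal (hgen.G_ne_top hD hn) (hD.G_proper.1 _)]

theorem Generates.gradX_eq (hgen : D.Generates x y z u) (hτ : 0 < D.τ) (n : ℕ) :
    D.gradX (x n) (y (n + 1)) = -(D.τ • (x (n + 1) - x n)) - D.At (u n)
      - D.β • D.At (D.A (x n) - z (n + 1)) := by
  have h := hgen.x_step n
  have h1 : D.τ • (x (n + 1) - x n) = -(D.gradX (x n) (y (n + 1)) + D.At (u n)
      + D.β • D.At (D.A (x n) - z (n + 1))) := by
    rw [h, sub_sub_cancel_left, smul_neg, smul_smul, mul_inv_cancel₀ hτ.ne', one_smul]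
  rw [h1]
  abel

theorem Generates.residual_eq (hgen : D.Generates x y z u) (hσ : 0 < D.σ) (hβ : 0 < D.β) (n : ℕ) :
    D.A (x (n + 1)) - z (n + 1) = (D.σ * D.β)⁻¹ • (u (n + 1) - u n) := by
  rw [hgen.u_step n, add_sub_cancel_left, smul_smul, inv_mul_cancel₀ (by positivity), one_smul]

/-- Compare the minimizers z (n + 1) and y (n + 1) with their predecessors, and apply the descent
lemma to H first in y at x n, then in x at y (n + 1); the x step cancels the linear terms. The index
0 is excluded because F (z 0) and G (y 0) may be +∞. -/
theorem Generates.lagrangian_descent (hgen : D.Generates x y z u) (hD : D.Standing)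
    {B₁ : Set (Euc m)} {B₂ : Set (Euc q)} (hB₁ : Convex ℝ B₁) (hB₂ : Convex ℝ B₂)
    (hxB : ∀ n, x n ∈ B₁) (hyB : ∀ n, y n ∈ B₂) (hLip : D.GradLipschitzOn B₁ B₂) {n : ℕ}
    (hn : 1 ≤ n) :
    (D.F (z (n + 1))).toReal + (D.G (y (n + 1))).toReal + D.H (x (n + 1)) (y (n + 1))
        + inner ℝ (u (n + 1)) (D.A (x (n + 1)) - z (n + 1))
        + D.β / 2 * ‖D.A (x (n + 1)) - z (n + 1)‖ ^ 2 ≤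
      (D.F (z n)).toReal + (D.G (y n)).toReal + D.H (x n) (y n)
        + inner ℝ (u n) (D.A (x n) - z n) + D.β / 2 * ‖D.A (x n) - z n‖ ^ 2
        - (D.τ - (D.L + D.β * ‖D.A‖ ^ 2) / 2) * ‖x (n + 1) - x n‖ ^ 2
        - (D.μ - D.L) / 2 * ‖y (n + 1) - y n‖ ^ 2
        + 1 / (D.σ * D.β) * ‖u (n + 1) - u n‖ ^ 2 := by
  have hβ := hD.β_pos
  have hσ := hD.σ_pos
  have hF : (D.F (z (n + 1))).toReal + (inner ℝ (u n) (D.A (x n) - z (n + 1))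
      + D.β / 2 * ‖D.A (x n) - z (n + 1)‖ ^ 2) - (inner ℝ (u n) (D.A (x n) - z n)
      + D.β / 2 * ‖D.A (x n) - z n‖ ^ 2) ≤ (D.F (z n)).toReal := by
    have := (hgen.z_step n).coe_toReal_add_sub_le hD.F_proper (z n)
    rw [← EReal.coe_toReal (hgen.F_ne_top hD hn) (hD.F_proper.1 _)] at this
    exact_mod_cast this
  have hG : (D.G (y (n + 1))).toReal + (inner ℝ (D.gradY (x n) (y n)) (y (n + 1))
      + D.μ / 2 * ‖y (n + 1) - y n‖ ^ 2) - (inner ℝ (D.gradY (x n) (y n)) (y n)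
      + D.μ / 2 * ‖y n - y n‖ ^ 2) ≤ (D.G (y n)).toReal := by
    have := (hgen.y_step n).coe_toReal_add_sub_le hD.G_proper (y n)
    rw [← EReal.coe_toReal (hgen.G_ne_top hD hn) (hD.G_proper.1 _)] at this
    exact_mod_cast this
  rw [sub_self, norm_zero] at hG
  have hHy := le_add_inner_gradient_add_sq (differentiable_H_right hD.H_diff (x n)) hB₂ (K := D.L)
    (fun a ha b hb => by
      simpa [gradY] using hLip.gradY_sub_le hD.L_pos.le (hxB n) ha (hxB n) hb) (hyB n) (hyB (n + 1))
  have hHx := le_add_inner_gradient_add_sq (differentiable_H_left hD.H_diff (y (n + 1))) hB₁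
    (K := D.L) (fun a ha b hb => by
      simpa [gradX] using hLip.gradX_sub_le hD.L_pos.le ha (hyB (n + 1)) hb (hyB (n + 1)))
    (hxB n) (hxB (n + 1))
  change _ ≤ D.H (x n) (y n) + inner ℝ (D.gradY (x n) (y n)) (y (n + 1) - y n) + _ at hHy
  change _ ≤ D.H (x n) (y (n + 1)) + inner ℝ (D.gradX (x n) (y (n + 1))) (x (n + 1) - x n) + _
    at hHx
  rw [inner_sub_right] at hHy
  have hAe : D.A (x (n + 1)) - z (n + 1) = (D.A (x n) - z (n + 1)) + D.A (x (n + 1) - x n) := by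
    rw [map_sub]; abel
  have hu : inner ℝ (u (n + 1)) (D.A (x (n + 1)) - z (n + 1)) =
      inner ℝ (u n) (D.A (x (n + 1)) - z (n + 1)) + 1 / (D.σ * D.β) * ‖u (n + 1) - u n‖ ^ 2 := by
    have h1 : inner ℝ (u (n + 1) - u n) (D.A (x (n + 1)) - z (n + 1)) =
        1 / (D.σ * D.β) * ‖u (n + 1) - u n‖ ^ 2 := by
      rw [hgen.residual_eq hσ hβ, real_inner_smul_right, real_inner_self_eq_norm_sq, one_div]
    rw [inner_sub_left] at h1
    linarith
  rw [hu, hAe, inner_add_right, norm_add_sq_real]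
  rw [hgen.gradX_eq hD.τ_pos, inner_sub_left, inner_sub_left, inner_neg_left, real_inner_smul_left,
    real_inner_smul_left, inner_At, inner_At, real_inner_self_eq_norm_sq] at hHx
  have hA : ‖D.A (x (n + 1) - x n)‖ ^ 2 ≤ ‖D.A‖ ^ 2 * ‖x (n + 1) - x n‖ ^ 2 := by
    rw [← mul_pow]
    exact pow_le_pow_left₀ (norm_nonneg _) (D.A.le_opNorm _) 2
  have hA' := mul_le_mul_of_nonneg_left hA (show 0 ≤ D.β / 2 by positivity)
  linarith

/-- The recursion behind the regularization terms. -/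
theorem Generates.regularization_step (hgen : D.Generates x y z u) (hD : D.Standing) (n : ℕ) :
    D.At (u (n + 2) - u (n + 1)) + D.σ • D.B (x (n + 2) - x (n + 1)) =
      (1 - D.σ) • (D.At (u (n + 1) - u n) + D.σ • D.B (x (n + 1) - x n)) +
      D.σ • (D.σ • D.B (x (n + 1) - x n) -
        (D.gradX (x (n + 1)) (y (n + 2)) - D.gradX (x n) (y (n + 1)))) := by
  have hβ := hD.β_pos
  have hσ := hD.σ_pos
  -- Apply Aᵀ to the dual step and eliminate z (k + 1) through the x step; differencing two
  -- consecutive instances gives the claim.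
  have key : ∀ k, D.At (u (k + 1)) = (1 - D.σ) • D.At (u k) -
      D.σ • (D.B (x (k + 1) - x k) + D.gradX (x k) (y (k + 1))) := by
    intro k
    have h1 : u (k + 1) = u k + (D.σ * D.β) • ((D.A (x k) - z (k + 1)) + D.A (x (k + 1) - x k)) := by
      rw [hgen.u_step k, map_sub]
      congr 2
      abel
    rw [h1, hgen.gradX_eq hD.τ_pos, B_apply, map_add, map_smul, map_add]
    module
  have h0 := key n
  have h1 := key (n + 1)
  have e : D.At (u (n + 2)) - D.At (u (n + 1)) = (1 - D.σ) • (D.At (u (n + 1)) - D.At (u n)) -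
      D.σ • (D.B (x (n + 2) - x (n + 1)) + D.gradX (x (n + 1)) (y (n + 2))) +
      D.σ • (D.B (x (n + 1) - x n) + D.gradX (x n) (y (n + 1))) := by
    rw [smul_sub]
    rw [show n + 1 + 1 = n + 2 from rfl] at h1
    rw [h1]
    nth_rewrite 2 [h0]
    abel
  rw [map_sub D.At, map_sub D.At, e]
  module

theorem norm_sq_convex_comb_le {E : Type*} [NormedAddCommGroup E] [InnerProductSpace ℝ E] {t : ℝ}
    (h0 : 0 ≤ t) (h1 : t ≤ 1) (a b : E) :
    ‖(1 - t) • a + t • b‖ ^ 2 ≤ (1 - t) * ‖a‖ ^ 2 + t * ‖b‖ ^ 2 := by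
  have h : ‖(1 - t) • a + t • b‖ ^ 2 =
      (1 - t) * ‖a‖ ^ 2 + t * ‖b‖ ^ 2 - t * (1 - t) * ‖a - b‖ ^ 2 := by
    rw [norm_add_sq_real, norm_sub_sq_real, norm_smul, norm_smul, real_inner_smul_left,
      real_inner_smul_right, Real.norm_of_nonneg h0, Real.norm_of_nonneg (sub_nonneg.2 h1)]
    ring
  have := mul_nonneg (mul_nonneg h0 (sub_nonneg.2 h1)) (sq_nonneg ‖a - b‖)
  linarith

theorem Generates.psiVal_descent (hp : 0 < p) (hgen : D.Generates x y z u) (hD : D.Standing)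
    {B₁ : Set (Euc m)} {B₂ : Set (Euc q)} (hB₁ : Convex ℝ B₁) (hB₂ : Convex ℝ B₂)
    (hxB : ∀ n, x n ∈ B₁) (hyB : ∀ n, y n ∈ B₂) (hLip : D.GradLipschitzOn B₁ B₂) {n : ℕ}
    (hn : 1 ≤ n) :
    D.C₂ * ‖x (n + 1) - x n‖ ^ 2 + D.C₃ * ‖y (n + 1) - y n‖ ^ 2 + D.C₄ * ‖u (n + 1) - u n‖ ^ 2 ≤
      D.psiVal x y z u n - D.psiVal x y z u (n + 1) := by
  have hβ := hD.β_pos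
  have hσ := hD.σ_pos
  have hτ := hD.τ_pos
  have hL := hD.L_pos
  have hraw := hgen.lagrangian_descent hD hB₁ hB₂ hxB hyB hLip hn
  obtain ⟨n, rfl⟩ := Nat.exists_eq_add_of_le' hn
  have hl := lamMin_pos hp hD.A_surj
  simp only [psiVal, smoothPart, Nat.add_sub_cancel]
  rw [show n + 1 + 1 = n + 2 from rfl] at *
  set l := lamMin D.A with hl_def
  set w₁ := D.At (u (n + 2) - u (n + 1)) + D.σ • D.B (x (n + 2) - x (n + 1)) with hw₁
  set w₀ := D.At (u (n + 1) - u n) + D.σ • D.B (x (n + 1) - x n) with hw₀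
  set h := D.gradX (x (n + 1)) (y (n + 2)) - D.gradX (x n) (y (n + 1)) with hh
  have hu := lamMin_mul_sq_le hp D.A (u (n + 2) - u (n + 1))
  change l * _ ≤ ‖D.At _‖ ^ 2 at hu
  have hBx : ∀ v, ‖D.σ • D.B v‖ ≤ D.σ * D.τ * ‖v‖ := fun v => by
    rw [norm_smul, Real.norm_of_nonneg hσ.le, mul_assoc]
    exact mul_le_mul_of_nonneg_left (norm_B_apply_le hβ.le hτ.le hD.two_τ v) hσ.le
  have hAt : ‖D.At (u (n + 2) - u (n + 1))‖ ^ 2 ≤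
      2 * ‖w₁‖ ^ 2 + 2 * (D.σ * D.τ * ‖x (n + 2) - x (n + 1)‖) ^ 2 := by
    have e : D.At (u (n + 2) - u (n + 1)) = w₁ - D.σ • D.B (x (n + 2) - x (n + 1)) := by
      rw [hw₁, add_sub_cancel_right]
    have h1 : ‖D.At (u (n + 2) - u (n + 1))‖ ≤ ‖w₁‖ + D.σ * D.τ * ‖x (n + 2) - x (n + 1)‖ := by
      rw [e]
      exact (norm_sub_le _ _).trans (add_le_add le_rfl (hBx _))
    have h2 := pow_le_pow_left₀ (norm_nonneg _) h1 2
    nlinarith [sq_nonneg (‖w₁‖ - D.σ * D.τ * ‖x (n + 2) - x (n + 1)‖)]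
  have hr : ‖D.σ • D.B (x (n + 1) - x n) - h‖ ^ 2 ≤
      2 * ((D.σ * D.τ + D.L) * ‖x (n + 1) - x n‖) ^ 2 +
        2 * (D.L * ‖y (n + 2) - y (n + 1)‖) ^ 2 := by
    have h1 : ‖D.σ • D.B (x (n + 1) - x n) - h‖ ≤
        (D.σ * D.τ + D.L) * ‖x (n + 1) - x n‖ + D.L * ‖y (n + 2) - y (n + 1)‖ := by
      have h2 := hLip.gradX_sub_le hL.le (hxB (n + 1)) (hyB (n + 2)) (hxB n) (hyB (n + 1))
      have h3 := norm_sub_le (D.σ • D.B (x (n + 1) - x n)) h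
      have h4 := hBx (x (n + 1) - x n)
      linarith
    have h2 := pow_le_pow_left₀ (norm_nonneg _) h1 2
    nlinarith [sq_nonneg ((D.σ * D.τ + D.L) * ‖x (n + 1) - x n‖ - D.L * ‖y (n + 2) - y (n + 1)‖)]
  -- Convexity of the squared norm in the recursion for w; the difference ‖w₀‖² - ‖w₁‖² is what the
  -- C₀ term of Ψ telescopes.
  have hw : D.σ * ‖w₁‖ ^ 2 ≤ (1 - D.σ) * (‖w₀‖ ^ 2 - ‖w₁‖ ^ 2) +
      D.σ * ‖D.σ • D.B (x (n + 1) - x n) - h‖ ^ 2 := by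
    have := norm_sq_convex_comb_le hσ.le hD.σ_le w₀ (D.σ • D.B (x (n + 1) - x n) - h)
    rw [← hgen.regularization_step hD n] at this
    linarith
  set K := 4 / (D.σ * D.β * l) with hK
  have hK0 : 0 < K := by positivity
  have hC₀ : D.C₀ = K / D.σ * (1 - D.σ) := by
    rw [C₀, hK, ← hl_def]; field_simp
  have hC₁ : D.C₁ = 2 * K * (D.σ * D.τ + D.L * √2) ^ 2 := by
    rw [C₁, hK, ← hl_def]; field_simp; norm_num
  have hC₂ : D.C₂ = D.τ - (D.L * √2 + D.β * ‖D.A‖ ^ 2) / 2 - K * (D.σ * D.τ) ^ 2 - D.C₁ := by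
    rw [C₂, C₁, hK, ← hl_def]; congr 2; field_simp
  have hC₃ : D.C₃ = (D.μ - D.L * √2) / 2 - 4 * K * D.L ^ 2 := by
    rw [C₃, hK, ← hl_def]; congr 1; field_simp; norm_num
  have hC₄ : D.C₄ = 1 / (D.σ * D.β) := rfl
  -- Twice the increase caused by the dual step is bounded: one copy cancels that increase, the
  -- other becomes the C₄ term.
  have hu' : 2 * (1 / (D.σ * D.β)) * ‖u (n + 2) - u (n + 1)‖ ^ 2 ≤
      K / 2 * ‖D.At (u (n + 2) - u (n + 1))‖ ^ 2 := by
    have := mul_le_mul_of_nonneg_left hu (show 0 ≤ K / 2 by positivity)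
    have e : K / 2 * (l * ‖u (n + 2) - u (n + 1)‖ ^ 2) =
        2 * (1 / (D.σ * D.β)) * ‖u (n + 2) - u (n + 1)‖ ^ 2 := by
      rw [hK]; field_simp; norm_num
    linarith
  have hAt' := mul_le_mul_of_nonneg_left hAt (show 0 ≤ K / 2 by positivity)
  have hw' : K * ‖w₁‖ ^ 2 ≤ D.C₀ * ‖w₀‖ ^ 2 - D.C₀ * ‖w₁‖ ^ 2 +
      K * ‖D.σ • D.B (x (n + 1) - x n) - h‖ ^ 2 := by
    have := mul_le_mul_of_nonneg_left hw (show 0 ≤ K / D.σ by positivity)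
    have e1 : K / D.σ * (D.σ * ‖w₁‖ ^ 2) = K * ‖w₁‖ ^ 2 := by field_simp
    have e2 : K / D.σ * ((1 - D.σ) * (‖w₀‖ ^ 2 - ‖w₁‖ ^ 2) +
      D.σ * ‖D.σ • D.B (x (n + 1) - x n) - h‖ ^ 2) = K / D.σ * (1 - D.σ) * ‖w₀‖ ^ 2 -
        K / D.σ * (1 - D.σ) * ‖w₁‖ ^ 2 + K * ‖D.σ • D.B (x (n + 1) - x n) - h‖ ^ 2 := by
      field_simp
    rw [e1, e2] at this
    rwa [hC₀]
  have hr' := mul_le_mul_of_nonneg_left hr hK0.le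
  -- The estimates so far need only L; the factor √2 and half of the 16 in C₃ are slack.
  have hLs : D.L ≤ D.L * √2 := le_mul_of_one_le_right hL.le (Real.one_le_sqrt.2 one_le_two)
  have hC₁' : 2 * K * (D.σ * D.τ + D.L) ^ 2 * ‖x (n + 1) - x n‖ ^ 2 ≤
      D.C₁ * ‖x (n + 1) - x n‖ ^ 2 := by
    rw [hC₁]
    refine mul_le_mul_of_nonneg_right (mul_le_mul_of_nonneg_left ?_ (by positivity)) (sq_nonneg _)
    exact pow_le_pow_left₀ (by positivity) (by linarith) 2
  have hx2 := mul_le_mul_of_nonneg_right hLs (sq_nonneg ‖x (n + 2) - x (n + 1)‖)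
  have hy2 := mul_le_mul_of_nonneg_right hLs (sq_nonneg ‖y (n + 2) - y (n + 1)‖)
  have hy3 : 0 ≤ 2 * K * D.L ^ 2 * ‖y (n + 2) - y (n + 1)‖ ^ 2 := by positivity
  rw [hC₂, hC₃, hC₄]
  linarith

end SplitData

namespace SplitData

variable {m q p : ℕ} {D : SplitData m q p}

/-! ### Subgradients along the algorithm -/

section Derivatives

variable {E : Type*} [NormedAddCommGroup E] [NormedSpace ℝ E]

theorem hasFDerivAt_const_mul_norm_sq {V : Type*} [NormedAddCommGroup V] [InnerProductSpace ℝ V]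
    {f : E → V} {f' : E →L[ℝ] V} {a : E} (c : ℝ) (hf : HasFDerivAt f f' a) :
    HasFDerivAt (fun v => c * ‖f v‖ ^ 2) ((2 * c) • (innerSL ℝ (f a)).comp f') a := by
  refine (hf.norm_sq.const_mul c).congr_fderiv ?_
  ext v
  simp
  ring

/-- The coordinates are arbitrary continuous linear maps, which keeps the nested product space out
of the calculation. -/
theorem exists_hasFDerivAt_smoothPart
    (hH : Differentiable ℝ (fun w : Euc m × Euc q => D.H w.1 w.2))
    (px px' : E →L[ℝ] Euc m) (py : E →L[ℝ] Euc q) (pz pu pu' : E →L[ℝ] Euc p) (a : E) :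
    ∃ T : E →L[ℝ] ℝ,
      HasFDerivAt (fun v => D.smoothPart (px v) (py v) (pz v) (pu v) (px' v) (pu' v)) T a ∧
      ∀ v, T v = inner ℝ (D.gradX (px a) (py a)) (px v) + inner ℝ (D.gradY (px a) (py a)) (py v) +
        (inner ℝ (pu a) (D.A (px v) - pz v) + inner ℝ (pu v) (D.A (px a) - pz a)) +
        D.β * inner ℝ (D.A (px a) - pz a) (D.A (px v) - pz v) +
        2 * D.C₀ * inner ℝ (D.At (pu a - pu' a) + D.σ • D.B (px a - px' a))
          (D.At (pu v - pu' v) + D.σ • D.B (px v - px' v)) +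
        2 * D.C₁ * inner ℝ (px a - px' a) (px v - px' v) := by
  have h1 : HasFDerivAt (fun v => D.H (px v) (py v)) _ a :=
    HasFDerivAt.comp (g := fun w : Euc m × Euc q => D.H w.1 w.2) a
      (hasFDerivAt_H hH (px a) (py a)) (px.hasFDerivAt.prodMk py.hasFDerivAt)
  have hr : HasFDerivAt (fun v => D.A (px v) - pz v) (D.A.comp px - pz) a :=
    (D.A.comp px - pz).hasFDerivAt
  have h2 := pu.hasFDerivAt (x := a).inner ℝ hr
  have h3 := hasFDerivAt_const_mul_norm_sq (D.β / 2) hr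
  have hw : HasFDerivAt (fun v => D.At (pu v - pu' v) + D.σ • D.B (px v - px' v))
      (D.At.comp (pu - pu') + D.σ • D.B.comp (px - px')) a :=
    (D.At.comp (pu - pu') + D.σ • D.B.comp (px - px')).hasFDerivAt
  have h4 := hasFDerivAt_const_mul_norm_sq D.C₀ hw
  have h5 := hasFDerivAt_const_mul_norm_sq D.C₁ ((px - px').hasFDerivAt (x := a))
  refine ⟨_, (((h1.add h2).add h3).add h4).add h5, fun v => ?_⟩
  simp [fderivInnerCLM_apply, inner_add_left, inner_add_right, inner_sub_left, inner_sub_right,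
    real_inner_smul_left, real_inner_smul_right]
  ring

theorem exists_hasFDerivAt_stepZ (pz : E →L[ℝ] Euc p) (U b : Euc p) (β : ℝ) (a : E) :
    ∃ T : E →L[ℝ] ℝ,
      HasFDerivAt (fun v => inner ℝ U (b - pz v) + β / 2 * ‖b - pz v‖ ^ 2) T a ∧
      ∀ v, T v = -inner ℝ (U + β • (b - pz a)) (pz v) := by
  have hr : HasFDerivAt (fun v => b - pz v) (-pz) a := pz.hasFDerivAt.const_sub b
  have h1 := (hasFDerivAt_const U a).inner ℝ hr
  refine ⟨_, h1.add (hasFDerivAt_const_mul_norm_sq (β / 2) hr), fun v => ?_⟩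
  simp [fderivInnerCLM_apply, inner_add_left, inner_sub_left, real_inner_smul_left]
  ring

theorem exists_hasFDerivAt_stepY (py : E →L[ℝ] Euc q) (g b : Euc q) (μ : ℝ) (a : E) :
    ∃ T : E →L[ℝ] ℝ,
      HasFDerivAt (fun v => inner ℝ g (py v) + μ / 2 * ‖py v - b‖ ^ 2) T a ∧
      ∀ v, T v = inner ℝ (g + μ • (py a - b)) (py v) := by
  have hr : HasFDerivAt (fun v => py v - b) py a := py.hasFDerivAt.sub_const b
  have h1 := (hasFDerivAt_const g a).inner ℝ (py.hasFDerivAt (x := a))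
  refine ⟨_, h1.add (hasFDerivAt_const_mul_norm_sq (μ / 2) hr), fun v => ?_⟩
  simp [fderivInnerCLM_apply, inner_add_left, inner_sub_left, real_inner_smul_left]
  exact Or.inl (by ring)

end Derivatives

theorem abs_inner_le_of_le {V : Type*} [NormedAddCommGroup V] [InnerProductSpace ℝ V] {a b : V}
    {s t : ℝ} (ha : ‖a‖ ≤ s) (hb : ‖b‖ ≤ t) : |inner ℝ a b| ≤ s * t :=
  (abs_real_inner_le_norm a b).trans
    (mul_le_mul ha hb (norm_nonneg _) ((norm_nonneg _).trans ha))

variable {x : ℕ → Euc m} {y : ℕ → Euc q} {z u : ℕ → Euc p}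

/-- The factor in the estimate of the subgradients by the step lengths. -/
def subgradientConst (D : SplitData m q p) : ℝ :=
  (D.L + D.τ + ‖D.A‖ + D.β * ‖D.A‖ * ‖D.A‖) + (D.L + D.μ) + (1 + D.β * ‖D.A‖) +
    (D.σ * D.β)⁻¹ + |2 * D.C₀| * ((‖D.A‖ + D.σ * D.τ) * (2 * ‖D.A‖ + 2 * (D.σ * D.τ))) +
    |2 * D.C₁| * 2

/-- Subtracting the quadratic models of the z and y steps leaves a derivative in which the step
equations turn every coefficient into an increment of x, y or u. -/
theorem Generates.exists_hasFDerivAt_minorant (hgen : D.Generates x y z u) (hD : D.Standing)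
    {B₁ : Set (Euc m)} {B₂ : Set (Euc q)} (hxB : ∀ n, x n ∈ B₁) (hyB : ∀ n, y n ∈ B₂)
    (hLip : D.GradLipschitzOn B₁ B₂) {E : Type*} [NormedAddCommGroup E] [NormedSpace ℝ E]
    {px px' : E →L[ℝ] Euc m} {py : E →L[ℝ] Euc q} {pz pu pu' : E →L[ℝ] Euc p}
    (nx : ∀ V, ‖px V‖ ≤ ‖V‖) (ny : ∀ V, ‖py V‖ ≤ ‖V‖) (nz : ∀ V, ‖pz V‖ ≤ ‖V‖)
    (nu : ∀ V, ‖pu V‖ ≤ ‖V‖) (nx' : ∀ V, ‖px' V‖ ≤ ‖V‖) (nu' : ∀ V, ‖pu' V‖ ≤ ‖V‖)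
    (n : ℕ) {X : E} (ex : px X = x (n + 1)) (ey : py X = y (n + 1)) (ez : pz X = z (n + 1))
    (eu : pu X = u (n + 1)) (ex' : px' X = x n) (eu' : pu' X = u n) :
    ∃ T : E →L[ℝ] ℝ, HasFDerivAt (fun V =>
      D.smoothPart (px V) (py V) (pz V) (pu V) (px' V) (pu' V) -
        (inner ℝ (u n) (D.A (x n) - pz V) + D.β / 2 * ‖D.A (x n) - pz V‖ ^ 2) -
        (inner ℝ (D.gradY (x n) (y n)) (py V) + D.μ / 2 * ‖py V - y n‖ ^ 2)) T X ∧
      ‖T‖ ≤ D.subgradientConst *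
        (‖x (n + 1) - x n‖ + ‖y (n + 1) - y n‖ + ‖u (n + 1) - u n‖) := by
  have hβ := hD.β_pos
  have hσ := hD.σ_pos
  have hτ := hD.τ_pos
  have hL := hD.L_pos
  have hμ := hD.μ_pos
  have hA0 := norm_nonneg D.A
  obtain ⟨T₁, hT₁, hT₁v⟩ := exists_hasFDerivAt_smoothPart hD.H_diff px px' py pz pu pu' X
  obtain ⟨T₂, hT₂, hT₂v⟩ := exists_hasFDerivAt_stepZ pz (u n) (D.A (x n)) D.β X
  obtain ⟨T₃, hT₃, hT₃v⟩ := exists_hasFDerivAt_stepY py (D.gradY (x n) (y n)) (y n) D.μ X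
  set Δx := x (n + 1) - x n with hΔx
  set Δy := y (n + 1) - y n with hΔy
  set Δu := u (n + 1) - u n with hΔu
  set s := ‖Δx‖ + ‖Δy‖ + ‖Δu‖ with hs
  set w := D.At Δu + D.σ • D.B Δx with hw
  -- The coefficients of the x, y and z directions, with the sign of vz reversed, apart from the
  -- regularization terms.
  set vx := (D.gradX (x (n + 1)) (y (n + 1)) - D.gradX (x n) (y (n + 1))) - D.τ • Δx + D.At Δu +
    D.β • D.At (D.A Δx) with hvx
  set vy := (D.gradY (x (n + 1)) (y (n + 1)) - D.gradY (x n) (y n)) - D.μ • Δy with hvy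
  set vz := Δu + D.β • D.A Δx with hvz
  have hT : ∀ V, (T₁ - T₂ - T₃) V = inner ℝ vx (px V) + inner ℝ vy (py V) - inner ℝ vz (pz V) +
      inner ℝ ((D.σ * D.β)⁻¹ • Δu) (pu V) +
      2 * D.C₀ * inner ℝ w (D.At (pu V - pu' V) + D.σ • D.B (px V - px' V)) +
      2 * D.C₁ * inner ℝ Δx (px V - px' V) := by
    intro V
    have e1 : D.gradX (x (n + 1)) (y (n + 1)) = vx - D.At (u (n + 1)) -
        D.β • D.At (D.A (x (n + 1)) - z (n + 1)) := by
      rw [hvx, hgen.gradX_eq hD.τ_pos, hΔu, hΔx]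
      simp only [map_sub]
      module
    have e2 : D.gradY (x (n + 1)) (y (n + 1)) = vy + D.gradY (x n) (y n) + D.μ • Δy := by
      rw [hvy]; abel
    have e3 : u n + D.β • (D.A (x n) - z (n + 1)) =
        u (n + 1) + D.β • (D.A (x (n + 1)) - z (n + 1)) - vz := by
      rw [hvz, hΔu, hΔx]
      simp only [map_sub]
      module
    rw [sub_apply, sub_apply, hT₁v, hT₂v, hT₃v, ex, ey, ez,
      eu, ex', eu', e1, e2, e3, ← hgen.residual_eq hσ hβ,
      real_inner_comm (D.A (x (n + 1)) - z (n + 1)) (pu V), ← hΔu, ← hΔx, ← hΔy, ← hw]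
    simp only [inner_add_left, inner_sub_left, real_inner_smul_left, inner_At, inner_sub_right]
    ring
  have hs0 : 0 ≤ s := by positivity
  have sx : ‖Δx‖ ≤ s := by rw [hs]; linarith [norm_nonneg Δy, norm_nonneg Δu]
  have sy : ‖Δy‖ ≤ s := by rw [hs]; linarith [norm_nonneg Δx, norm_nonneg Δu]
  have su : ‖Δu‖ ≤ s := by rw [hs]; linarith [norm_nonneg Δy, norm_nonneg Δx]
  have hAle : ∀ (v : Euc m) {t : ℝ}, ‖v‖ ≤ t → ‖D.A v‖ ≤ ‖D.A‖ * t := fun v t ht =>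
    D.A.le_opNorm_of_le ht
  have hAtle : ∀ (v : Euc p) {t : ℝ}, ‖v‖ ≤ t → ‖D.At v‖ ≤ ‖D.A‖ * t := fun v t ht => by
    rw [← norm_At]; exact D.At.le_opNorm_of_le ht
  have hsm : ∀ {V : Type} [NormedAddCommGroup V] [NormedSpace ℝ V] (v : V) {c t : ℝ}, 0 ≤ c →
      ‖v‖ ≤ t → ‖c • v‖ ≤ c * t := fun v c t hc ht => by
    rw [norm_smul, Real.norm_of_nonneg hc]; exact mul_le_mul_of_nonneg_left ht hc
  have hBle : ∀ (v : Euc m) {t : ℝ}, ‖v‖ ≤ t → ‖D.σ • D.B v‖ ≤ D.σ * D.τ * t := fun v t ht => by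
    rw [mul_assoc]
    exact hsm _ hσ.le ((norm_B_apply_le hβ.le hτ.le hD.two_τ v).trans
      (mul_le_mul_of_nonneg_left ht hτ.le))
  have bx : ‖vx‖ ≤ (D.L + D.τ + ‖D.A‖ + D.β * ‖D.A‖ * ‖D.A‖) * s := by
    have h1 := hLip.gradX_sub_le hL.le (hxB (n + 1)) (hyB (n + 1)) (hxB n) (hyB (n + 1))
    rw [sub_self, norm_zero, add_zero] at h1
    have h2 := norm_add_le_of_le (norm_add_le_of_le (norm_sub_le_of_le
      (h1.trans (mul_le_mul_of_nonneg_left sx hL.le)) (hsm Δx hτ.le sx)) (hAtle Δu su))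
      (hsm _ hβ.le (hAtle _ (hAle Δx sx)))
    refine h2.trans (le_of_eq ?_)
    ring
  have b_y : ‖vy‖ ≤ (D.L + D.μ) * s := by
    have h1 := hLip.gradY_sub_le hL.le (hxB (n + 1)) (hyB (n + 1)) (hxB n) (hyB n)
    have h2 : ‖Δx‖ + ‖Δy‖ ≤ s := by rw [hs]; linarith [norm_nonneg Δu]
    refine (norm_sub_le_of_le (h1.trans (mul_le_mul_of_nonneg_left h2 hL.le))
      (hsm Δy hμ.le sy)).trans (le_of_eq ?_)
    ring
  have bz : ‖vz‖ ≤ (1 + D.β * ‖D.A‖) * s := by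
    refine (norm_add_le_of_le su (hsm _ hβ.le (hAle Δx sx))).trans (le_of_eq ?_)
    ring
  have bu : ‖(D.σ * D.β)⁻¹ • Δu‖ ≤ (D.σ * D.β)⁻¹ * s := hsm _ (by positivity) su
  have bw : ‖w‖ ≤ (‖D.A‖ + D.σ * D.τ) * s := by
    refine (norm_add_le_of_le (hAtle Δu su) (hBle Δx sx)).trans (le_of_eq ?_)
    ring
  refine ⟨T₁ - T₂ - T₃, (hT₁.sub hT₂).sub hT₃,
    ContinuousLinearMap.opNorm_le_bound _ (by rw [subgradientConst]; positivity) fun V => ?_⟩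
  have dx : ‖px V - px' V‖ ≤ 2 * ‖V‖ :=
    (norm_sub_le_of_le (nx V) (nx' V)).trans (le_of_eq (two_mul _).symm)
  have du : ‖pu V - pu' V‖ ≤ 2 * ‖V‖ :=
    (norm_sub_le_of_le (nu V) (nu' V)).trans (le_of_eq (two_mul _).symm)
  have i1 := abs_inner_le_of_le bx (nx V)
  have i2 := abs_inner_le_of_le b_y (ny V)
  have i3 := abs_inner_le_of_le bz (nz V)
  have i4 := abs_inner_le_of_le bu (nu V)
  have i5 := mul_le_mul_of_nonneg_left
    (abs_inner_le_of_le bw (norm_add_le_of_le (hAtle _ du) (hBle _ dx))) (abs_nonneg (2 * D.C₀))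
  have i6 := mul_le_mul_of_nonneg_left (abs_inner_le_of_le sx dx) (abs_nonneg (2 * D.C₁))
  rw [← abs_mul] at i5 i6
  rw [hT, Real.norm_eq_abs]
  refine (abs_add_le _ _).trans ?_
  refine (add_le_add ((abs_add_le _ _).trans (add_le_add ((abs_add_le _ _).trans (add_le_add
    ((abs_sub _ _).trans (add_le_add ((abs_add_le _ _).trans (add_le_add i1 i2)) i3)) i4)) i5))
    i6).trans (le_of_eq ?_)
  rw [subgradientConst]
  ring

theorem Generates.exists_subgradient_bound (hgen : D.Generates x y z u) (hD : D.Standing)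
    {B₁ : Set (Euc m)} {B₂ : Set (Euc q)} (hxB : ∀ n, x n ∈ B₁) (hyB : ∀ n, y n ∈ B₂)
    (hLip : D.GradLipschitzOn B₁ B₂) :
    ∃ K : ℝ, 0 < K ∧ ∀ n, ∃ d ∈ frechetSubdiff D.Psi (bigSeq x y z u (n + 1)),
      ‖d‖ ≤ K * (‖x (n + 1) - x n‖ + ‖y (n + 1) - y n‖ + ‖u (n + 1) - u n‖) := by
  have hβ := hD.β_pos
  have hσ := hD.σ_pos
  have hτ := hD.τ_pos
  have hL := hD.L_pos
  have hμ := hD.μ_pos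
  have hA0 := norm_nonneg D.A
  refine ⟨D.subgradientConst, by rw [subgradientConst]; positivity, fun n => ?_⟩
  let s1 := WithLp.sndL 2 ℝ (Euc m) (WithLp 2 (Euc q × WithLp 2 (Euc p × WithLp 2 (Euc p ×
    WithLp 2 (Euc m × Euc p)))))
  let s2 := (WithLp.sndL 2 ℝ (Euc q) (WithLp 2 (Euc p × WithLp 2 (Euc p ×
    WithLp 2 (Euc m × Euc p))))).comp s1
  let s3 := (WithLp.sndL 2 ℝ (Euc p) (WithLp 2 (Euc p × WithLp 2 (Euc m × Euc p)))).comp s2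
  let s4 := (WithLp.sndL 2 ℝ (Euc p) (WithLp 2 (Euc m × Euc p))).comp s3
  let px : BigSpace m q p →L[ℝ] Euc m := WithLp.fstL 2 ℝ _ _
  let py : BigSpace m q p →L[ℝ] Euc q := (WithLp.fstL 2 ℝ _ _).comp s1
  let pz : BigSpace m q p →L[ℝ] Euc p := (WithLp.fstL 2 ℝ _ _).comp s2
  let pu : BigSpace m q p →L[ℝ] Euc p := (WithLp.fstL 2 ℝ _ _).comp s3
  let px' : BigSpace m q p →L[ℝ] Euc m := (WithLp.fstL 2 ℝ _ _).comp s4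
  let pu' : BigSpace m q p →L[ℝ] Euc p := (WithLp.sndL 2 ℝ _ _).comp s4
  have n1 : ∀ V : BigSpace m q p, ‖s1 V‖ ≤ ‖V‖ := fun V => WithLp.norm_snd_le _ V
  have n2 : ∀ V : BigSpace m q p, ‖s2 V‖ ≤ ‖V‖ := fun V => (WithLp.norm_snd_le _ _).trans (n1 V)
  have n3 : ∀ V : BigSpace m q p, ‖s3 V‖ ≤ ‖V‖ := fun V => (WithLp.norm_snd_le _ _).trans (n2 V)
  have n4 : ∀ V : BigSpace m q p, ‖s4 V‖ ≤ ‖V‖ := fun V => (WithLp.norm_snd_le _ _).trans (n3 V)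
  have nx : ∀ V : BigSpace m q p, ‖px V‖ ≤ ‖V‖ := fun V => WithLp.norm_fst_le _ V
  have ny : ∀ V : BigSpace m q p, ‖py V‖ ≤ ‖V‖ := fun V => (WithLp.norm_fst_le _ _).trans (n1 V)
  have nz : ∀ V : BigSpace m q p, ‖pz V‖ ≤ ‖V‖ := fun V => (WithLp.norm_fst_le _ _).trans (n2 V)
  have nu : ∀ V : BigSpace m q p, ‖pu V‖ ≤ ‖V‖ := fun V => (WithLp.norm_fst_le _ _).trans (n3 V)
  have nx' : ∀ V : BigSpace m q p, ‖px' V‖ ≤ ‖V‖ := fun V =>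
    (WithLp.norm_fst_le _ _).trans (n4 V)
  have nu' : ∀ V : BigSpace m q p, ‖pu' V‖ ≤ ‖V‖ := fun V =>
    (WithLp.norm_snd_le _ _).trans (n4 V)
  set X := bigSeq x y z u (n + 1) with hX
  have ex : px X = x (n + 1) := rfl
  have ey : py X = y (n + 1) := rfl
  have ez : pz X = z (n + 1) := rfl
  have eu : pu X = u (n + 1) := rfl
  have ex' : px' X = x n := rfl
  have eu' : pu' X = u n := rfl
  obtain ⟨T, hT, hTn⟩ := hgen.exists_hasFDerivAt_minorant hD hxB hyB hLip nx ny nz nu nx' nu' n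
    ex ey ez eu ex' eu'
  refine ⟨(InnerProductSpace.toDual ℝ _).symm T, ?_, ?_⟩
  -- c is the sum of the minimal values of the z and y subproblems, so that the minorant touches Ψ
  -- at X.
  · set c := (D.F (z (n + 1))).toReal + (inner ℝ (u n) (D.A (x n) - z (n + 1))
      + D.β / 2 * ‖D.A (x n) - z (n + 1)‖ ^ 2) + ((D.G (y (n + 1))).toReal +
      (inner ℝ (D.gradY (x n) (y n)) (y (n + 1)) + D.μ / 2 * ‖y (n + 1) - y n‖ ^ 2)) with hc
    refine mem_frechetSubdiff_of_minorant (Φ := fun V => c +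
      ((D.smoothPart (px V) (py V) (pz V) (pu V) (px' V) (pu' V) -
        (inner ℝ (u n) (D.A (x n) - pz V) + D.β / 2 * ‖D.A (x n) - pz V‖ ^ 2)) -
        (inner ℝ (D.gradY (x n) (y n)) (py V) + D.μ / 2 * ‖py V - y n‖ ^ 2))) ?_ ?_ fun V => ?_
    · refine (hT.const_add c).congr_fderiv ?_
      ext V
      simp
    · rw [hgen.Psi_bigSeq hD (Nat.le_add_left 1 n), psiVal, Nat.add_sub_cancel]
      norm_cast
      rw [ex, ey, ez, eu, ex', eu', hc]
      ring
    · have hF := (hgen.z_step n).coe_toReal_add_sub_le hD.F_proper (pz V)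
      have hG := (hgen.y_step n).coe_toReal_add_sub_le hD.G_proper (py V)
      have := add_le_add (add_le_add hF hG)
        (le_refl ((D.smoothPart (px V) (py V) (pz V) (pu V) (px' V) (pu' V) : ℝ) : EReal))
      refine le_trans (le_of_eq ?_) this
      norm_cast
      rw [hc]
      ring
  · rw [LinearIsometryEquiv.norm_map]
    exact hTn

end SplitData

/-! ### Convergence of subgradient descent sequences -/

theorem LojasiewiczAt.exists_rpow_le {E : Type*} [NormedAddCommGroup E] [InnerProductSpace ℝ E]
    {ψ : E → EReal} {w : E} {C θ : ℝ} (h : LojasiewiczAt ψ w C θ) (hC : 0 ≤ C) (hθ : 0 ≤ θ)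
    {b : ℝ} (hw : ψ w = b) :
    ∃ ε > 0, ∀ v ∈ Metric.ball w ε, ∀ a : ℝ, ψ v = a → b ≤ a → a - b ≠ 0 →
      ∀ d ∈ limitingSubdiff ψ v, (a - b) ^ θ ≤ C * ‖d‖ := by
  obtain ⟨ε, hε, h⟩ := h
  refine ⟨ε, hε, fun v hv a ha hba hab d hd => ?_⟩
  have hne : ψ v ≠ ψ w := by
    rw [ha, hw]
    exact_mod_cast sub_ne_zero.1 hab
  have h1 := (h v hv hne).trans (mul_le_mul_right (Metric.infEDist_le_edist_of_mem hd) _)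
  rw [ha, hw, ← EReal.coe_sub, EReal.abs_def, abs_of_nonneg (sub_nonneg.2 hba),
    ENNReal.ofReal_rpow_of_nonneg (sub_nonneg.2 hba) hθ, edist_dist, dist_zero_left,
    ← ENNReal.ofReal_mul hC] at h1
  exact (ENNReal.ofReal_le_ofReal_iff (by positivity)).1 h1

/-- The properties of a sequence `X`, with values `φ` of `ψ` and step lengths `s`, from which the
Łojasiewicz inequality yields convergence. -/
structure IsDescentSequence {E : Type*} [NormedAddCommGroup E] [InnerProductSpace ℝ E]
    (ψ : E → EReal) (X : ℕ → E) (φ s : ℕ → ℝ) (c K : ℝ) : Prop where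
  c_pos : 0 < c
  K_pos : 0 < K
  s_nonneg : ∀ n, 0 ≤ s n
  value : ∀ n, 1 ≤ n → ψ (X n) = (φ n : EReal)
  descent : ∀ n, 1 ≤ n → c * s (n + 1) ^ 2 ≤ φ n - φ (n + 1)
  subgradient : ∀ n, 1 ≤ n → ∃ d ∈ frechetSubdiff ψ (X n), ‖d‖ ≤ K * s n

namespace IsDescentSequence

variable {E : Type*} [NormedAddCommGroup E] [InnerProductSpace ℝ E] {ψ : E → EReal} {X : ℕ → E}
  {φ s : ℕ → ℝ} {c K : ℝ}

theorem succ_le (h : IsDescentSequence ψ X φ s c K) {n : ℕ} (hn : 1 ≤ n) : φ (n + 1) ≤ φ n := by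
  have := h.descent n hn
  have := mul_nonneg h.c_pos.le (sq_nonneg (s (n + 1)))
  linarith

theorem exists_tendsto_value (h : IsDescentSequence ψ X φ s c K) {b : ℝ}
    (hb : ∀ n, 1 ≤ n → b ≤ φ n) :
    ∃ Ps : ℝ, Tendsto φ atTop (𝓝 Ps) ∧ ∀ n, 1 ≤ n → Ps ≤ φ n := by
  have hanti : Antitone fun n => φ (n + 1) :=
    antitone_nat_of_succ_le fun n => h.succ_le (Nat.le_add_left 1 n)
  have hbdd : BddBelow (Set.range fun n => φ (n + 1)) :=
    ⟨b, by rintro _ ⟨n, rfl⟩; exact hb _ (Nat.le_add_left 1 n)⟩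
  refine ⟨_, (tendsto_add_atTop_iff_nat 1).1 (tendsto_atTop_ciInf hanti hbdd), fun n hn => ?_⟩
  obtain ⟨n, rfl⟩ := Nat.exists_eq_add_of_le' hn
  exact ciInf_le hbdd n

theorem tendsto_step (h : IsDescentSequence ψ X φ s c K) {Ps : ℝ} (hφ : Tendsto φ atTop (𝓝 Ps)) :
    Tendsto s atTop (𝓝 0) := by
  have hc := h.c_pos
  have h1 : Tendsto (fun n => √((φ n - φ (n + 1)) / c)) atTop (𝓝 0) := by
    have := ((hφ.sub (hφ.comp (tendsto_add_atTop_nat 1))).div_const c).sqrt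
    simpa using this
  refine (tendsto_add_atTop_iff_nat 1).1 (squeeze_zero' (Eventually.of_forall fun n => h.s_nonneg _)
    ?_ h1)
  filter_upwards [eventually_ge_atTop 1] with n hn
  refine Real.le_sqrt_of_sq_le ?_
  rw [le_div_iff₀ hc, mul_comm]
  exact h.descent n hn

/-- The steps tend to 0, hence so do the subgradients; with convergence of the values this is the
definition of 0 being a limiting subgradient. -/
theorem mem_critSet (h : IsDescentSequence ψ X φ s c K) {Ps : ℝ} (hφ : Tendsto φ atTop (𝓝 Ps))
    {k : ℕ → ℕ} (hk : Tendsto k atTop atTop) (hk1 : ∀ i, 1 ≤ k i) {w : E}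
    (hw : Tendsto (fun i => X (k i)) atTop (𝓝 w)) (hψ : ψ w = Ps) : w ∈ critSet ψ := by
  choose d hd hdK using fun i => h.subgradient (k i) (hk1 i)
  refine ⟨hψ ▸ EReal.coe_lt_top _, fun i => X (k i), d, hw, ?_, ?_, hd⟩
  · refine squeeze_zero_norm hdK ?_
    simpa using ((h.tendsto_step hφ).comp hk).const_mul K
  · simp only [fun i => h.value (k i) (hk1 i)]
    rw [hψ]
    exact (continuous_coe_real_ereal.tendsto _).comp (hφ.comp hk)

/-- The constant and exponent depend on the cluster point. If no single pair served a tail, it would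
fail with constants k and exponents 1 - 1/(k+1) at indices n k → ∞; a subsequence converges to a
critical point, whose own inequality is stronger for large k. -/
theorem exists_lojasiewicz (h : IsDescentSequence ψ X φ s c K) [ProperSpace E] {Ps : ℝ}
    (hφ : Tendsto φ atTop (𝓝 Ps)) (hle : ∀ n, 1 ≤ n → Ps ≤ φ n)
    (hX : Bornology.IsBounded (Set.range X))
    (hcluster : ∀ (k : ℕ → ℕ) (w : E), Tendsto k atTop atTop → (∀ i, 1 ≤ k i) →
      Tendsto (fun i => X (k i)) atTop (𝓝 w) → ψ w = Ps)
    (hLoj : HasLojasiewiczProperty ψ) :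
    ∃ M θ : ℝ, ∃ N : ℕ, 0 ≤ M ∧ 0 ≤ θ ∧ θ < 1 ∧ 1 ≤ N ∧
      ∀ n, N ≤ n → φ n - Ps ≠ 0 → (φ n - Ps) ^ θ ≤ M * s n := by
  by_contra hcon
  push Not at hcon
  have hθk : ∀ k : ℕ, (0 : ℝ) ≤ 1 - 1 / ((k : ℝ) + 1) := fun k => by
    rw [sub_nonneg, div_le_one (by positivity)]
    linarith [Nat.cast_nonneg (α := ℝ) k]
  choose n hn hn0 hns using fun k : ℕ => hcon k (1 - 1 / ((k : ℝ) + 1)) (k + 1) (Nat.cast_nonneg k)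
    (hθk k) (by linarith [show (0 : ℝ) < 1 / ((k : ℝ) + 1) by positivity]) (Nat.le_add_left 1 k)
  obtain ⟨w, -, j, hj, hw⟩ := tendsto_subseq_of_bounded hX (fun k => Set.mem_range_self (n k))
  have hnk : Tendsto (fun i => n (j i)) atTop atTop :=
    (tendsto_atTop_mono (fun k => (Nat.le_succ k).trans (hn k)) tendsto_id).comp hj.tendsto_atTop
  have hn1 : ∀ k, 1 ≤ n k := fun k => (Nat.le_add_left 1 k).trans (hn k)
  have hψ := hcluster (fun i => n (j i)) w hnk (fun i => hn1 _) hw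
  obtain ⟨C, θ, hC, hθ0, hθ1, hL⟩ :=
    hLoj w (h.mem_critSet hφ hnk (fun i => hn1 _) hw hψ)
  obtain ⟨ε, hε, hL⟩ := hL.exists_rpow_le hC.le hθ0 hψ
  have e1 : ∀ᶠ i in atTop, X (n (j i)) ∈ Metric.ball w ε := hw.eventually (Metric.ball_mem_nhds w hε)
  have e2 : ∀ᶠ i in atTop, φ (n (j i)) < Ps + 1 := (hφ.comp hnk).eventually (gt_mem_nhds (by linarith))
  have hjr : Tendsto (fun i => ((j i : ℕ) : ℝ)) atTop atTop :=
    tendsto_natCast_atTop_atTop.comp hj.tendsto_atTop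
  have e3 : ∀ᶠ i in atTop, C * K ≤ (j i : ℝ) := hjr.eventually_ge_atTop _
  have e4 : ∀ᶠ i in atTop, 1 / (1 - θ) ≤ (j i : ℝ) := hjr.eventually_ge_atTop _
  obtain ⟨i, i1, i2, i3, i4⟩ := (e1.and (e2.and (e3.and e4))).exists
  obtain ⟨d, hd, hdK⟩ := h.subgradient (n (j i)) (hn1 _)
  have a1 := hL _ i1 (φ (n (j i))) (h.value _ (hn1 _)) (hle _ (hn1 _)) (hn0 _) d
    (frechetSubdiff_subset_limitingSubdiff _ _ hd)
  have a2 : 0 < φ (n (j i)) - Ps :=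
    lt_of_le_of_ne (sub_nonneg.2 (hle _ (hn1 _))) (Ne.symm (hn0 _))
  have a3 : θ ≤ 1 - 1 / ((j i : ℝ) + 1) := by
    have : 1 / ((j i : ℝ) + 1) ≤ 1 - θ := by
      rw [div_le_iff₀ (by positivity)]
      rw [div_le_iff₀ (by linarith)] at i4
      linarith
    linarith
  -- Since 0 < φ - Ps < 1, raising the exponent from θ only lowers the power.
  have a4 := Real.rpow_le_rpow_of_exponent_ge a2 (by linarith) a3
  have a5 := hns (j i)
  have a6 : C * ‖d‖ ≤ j i * s (n (j i)) :=
    calc C * ‖d‖ ≤ C * (K * s (n (j i))) := mul_le_mul_of_nonneg_left hdK hC.le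
      _ = C * K * s (n (j i)) := by ring
      _ ≤ _ := mul_le_mul_of_nonneg_right i3 (h.s_nonneg _)
  linarith

theorem summable_step (h : IsDescentSequence ψ X φ s c K) [ProperSpace E] {Ps : ℝ}
    (hφ : Tendsto φ atTop (𝓝 Ps)) (hle : ∀ n, 1 ≤ n → Ps ≤ φ n)
    (hX : Bornology.IsBounded (Set.range X))
    (hcluster : ∀ (k : ℕ → ℕ) (w : E), Tendsto k atTop atTop → (∀ i, 1 ≤ k i) →
      Tendsto (fun i => X (k i)) atTop (𝓝 w) → ψ w = Ps)
    (hLoj : HasLojasiewiczProperty ψ) : Summable s := by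
  obtain ⟨M, θ, N, hM, hθ0, hθ1, hN, hloj⟩ := h.exists_lojasiewicz hφ hle hX hcluster hLoj
  exact summable_of_descent_of_lojasiewicz (E := fun n => φ n - Ps) h.c_pos hM hθ0 hθ1
    (fun n hn => sub_nonneg.2 (hle n (hN.trans hn))) h.s_nonneg
    (fun n hn => (h.descent n (hN.trans hn)).trans (by linarith)) hloj

/-- The recursion that determines the rate of convergence of the values. -/
theorem exists_rpow_le (h : IsDescentSequence ψ X φ s c K) {Ps : ℝ}
    (hφ : Tendsto φ atTop (𝓝 Ps)) (hle : ∀ n, 1 ≤ n → Ps ≤ φ n) {w : E}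
    (hw : Tendsto X atTop (𝓝 w)) (hψ : ψ w = Ps) {C θ : ℝ} (hC : 0 < C) (hθ : 0 ≤ θ)
    (hL : LojasiewiczAt ψ w C θ) :
    ∃ M : ℝ, 0 < M ∧ ∃ N : ℕ, 1 ≤ N ∧ ∀ n, N ≤ n → φ (n + 1) - Ps ≤ 1 ∧
      (φ (n + 1) - Ps ≠ 0 →
        (φ (n + 1) - Ps) ^ (2 * θ) ≤ M * ((φ n - Ps) - (φ (n + 1) - Ps))) := by
  obtain ⟨ε, hε, hL⟩ := hL.exists_rpow_le hC.le hθ hψ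
  have hc := h.c_pos
  have hK := h.K_pos
  have e1 : ∀ᶠ n in atTop, X n ∈ Metric.ball w ε := hw.eventually (Metric.ball_mem_nhds w hε)
  have e2 : ∀ᶠ n in atTop, φ n < Ps + 1 := hφ.eventually (gt_mem_nhds (by linarith))
  obtain ⟨N, hN⟩ := eventually_atTop.1 (e1.and e2)
  refine ⟨(C * K) ^ 2 / c, by positivity, max N 1, le_max_right _ _, fun n hn => ?_⟩
  have hn1 : 1 ≤ n := (le_max_right _ _).trans hn
  obtain ⟨i1, i2⟩ := hN (n + 1) (((le_max_left _ _).trans hn).trans n.le_succ)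
  refine ⟨by linarith, fun h0 => ?_⟩
  obtain ⟨d, hd, hdK⟩ := h.subgradient (n + 1) (Nat.le_add_left 1 n)
  have hle' := hle (n + 1) (Nat.le_add_left 1 n)
  have a1 := hL _ i1 (φ (n + 1)) (h.value _ (Nat.le_add_left 1 n)) hle' h0 d
    (frechetSubdiff_subset_limitingSubdiff _ _ hd)
  have a2 : (φ (n + 1) - Ps) ^ θ ≤ C * K * s (n + 1) :=
    a1.trans ((mul_le_mul_of_nonneg_left hdK hC.le).trans (le_of_eq (by ring)))
  -- Subgradient bound and descent involve the same step s (n + 1); squaring lets descent replace it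
  -- by the drop of the values.
  have a3 := pow_le_pow_left₀ (Real.rpow_nonneg (sub_nonneg.2 hle') θ) a2 2
  rw [mul_comm 2 θ, Real.rpow_mul (sub_nonneg.2 hle'), Real.rpow_two, sub_sub_sub_cancel_right]
  refine a3.trans ?_
  rw [mul_pow, div_mul_eq_mul_div, le_div_iff₀ hc, mul_assoc, mul_comm (s (n + 1) ^ 2) c]
  exact mul_le_mul_of_nonneg_left (h.descent n hn1) (by positivity)

theorem finite_termination (h : IsDescentSequence ψ X φ s c K) {Ps : ℝ}
    (hφ : Tendsto φ atTop (𝓝 Ps)) (hle : ∀ n, 1 ≤ n → Ps ≤ φ n) {w : E}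
    (hw : Tendsto X atTop (𝓝 w)) (hψ : ψ w = Ps) {C : ℝ} (hC : 0 < C)
    (hL : LojasiewiczAt ψ w C 0) : ∃ n₀ : ℕ, 1 ≤ n₀ ∧ ∀ n, n₀ ≤ n → φ n = Ps := by
  obtain ⟨M, -, N, -, hrec⟩ := h.exists_rpow_le hφ hle hw hψ hC le_rfl hL
  have hlim : Tendsto (fun n => φ n - Ps) atTop (𝓝 0) := by
    simpa using hφ.sub_const Ps
  have h1 := eventually_eq_zero_of_descent (M := M) hlim (eventually_atTop.2 ⟨N, fun n hn h0 => by
    simpa using (hrec n hn).2 h0⟩)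
  obtain ⟨N', hN'⟩ := eventually_atTop.1 h1
  exact ⟨max N' 1, le_max_right _ _, fun n hn => sub_eq_zero.1 (hN' n ((le_max_left _ _).trans hn))⟩

theorem linear_rate (h : IsDescentSequence ψ X φ s c K) {Ps : ℝ}
    (hφ : Tendsto φ atTop (𝓝 Ps)) (hle : ∀ n, 1 ≤ n → Ps ≤ φ n) {w : E}
    (hw : Tendsto X atTop (𝓝 w)) (hψ : ψ w = Ps) {C θ : ℝ} (hC : 0 < C) (hθ : 0 < θ)
    (hθ2 : θ ≤ 1 / 2) (hL : LojasiewiczAt ψ w C θ) :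
    ∃ n₀ : ℕ, 1 ≤ n₀ ∧ ∃ C Q : ℝ, 0 < C ∧ 0 ≤ Q ∧ Q < 1 ∧
      ∀ n, n₀ ≤ n → φ n - Ps ≤ C * Q ^ n := by
  obtain ⟨M, hM, N, hN, hrec⟩ := h.exists_rpow_le hφ hle hw hψ hC hθ.le hL
  refine ⟨N, hN, linear_rate_of_descent (E := fun n => φ n - Ps) hM
    (fun n hn => sub_nonneg.2 (hle n (hN.trans hn))) fun n hn => ?_⟩
  have hle' := hle (n + 1) (Nat.le_add_left 1 n)
  obtain ⟨i1, i2⟩ := hrec n hn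
  rcases eq_or_ne (φ (n + 1) - Ps) 0 with h0 | h0
  · simp only [h0, sub_zero]
    exact mul_nonneg hM.le (sub_nonneg.2 (hle n (hN.trans hn)))
  · refine le_trans ?_ (i2 h0)
    -- A number in (0, 1] is at most its power with exponent 2θ ≤ 1.
    have := Real.rpow_le_rpow_of_exponent_ge (lt_of_le_of_ne (sub_nonneg.2 hle') (Ne.symm h0)) i1
      (show 2 * θ ≤ 1 by linarith)
    rwa [Real.rpow_one] at this

theorem sublinear_rate (h : IsDescentSequence ψ X φ s c K) {Ps : ℝ}
    (hφ : Tendsto φ atTop (𝓝 Ps)) (hle : ∀ n, 1 ≤ n → Ps ≤ φ n) {w : E}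
    (hw : Tendsto X atTop (𝓝 w)) (hψ : ψ w = Ps) {C θ : ℝ} (hC : 0 < C) (hθ : 1 / 2 < θ)
    (hθ1 : θ < 1) (hL : LojasiewiczAt ψ w C θ) :
    ∃ n₀ : ℕ, 1 ≤ n₀ ∧ ∃ C : ℝ, 0 < C ∧
      ∀ n, n₀ ≤ n → φ n - Ps ≤ C * (n : ℝ) ^ (-(1 / (2 * θ - 1))) := by
  obtain ⟨M, hM, N, hN, hrec⟩ := h.exists_rpow_le hφ hle hw hψ hC (by linarith) hL
  refine ⟨N, hN, sublinear_rate_of_descent (E := fun n => φ n - Ps) hN hM (by linarith)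
    (by linarith) (fun n hn => sub_nonneg.2 (hle n (hN.trans hn))) fun n hn => ?_⟩
  rw [add_sub_cancel]
  rcases eq_or_ne (φ (n + 1) - Ps) 0 with h0 | h0
  · rw [h0, Real.zero_rpow (by linarith), sub_zero]
    exact mul_nonneg hM.le (sub_nonneg.2 (hle n (hN.trans hn)))
  · exact (hrec n hn).2 h0

end IsDescentSequence

/-! ### The iterates as a descent sequence: bounds, values at cluster points, limits -/

namespace SplitData

variable {m q p : ℕ} {D : SplitData m q p} {x : ℕ → Euc m} {y : ℕ → Euc q} {z u : ℕ → Euc p}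

theorem continuous_bigPoint : Continuous
    fun w : Euc m × Euc q × Euc p × Euc p × Euc m × Euc p =>
      bigPoint w.1 w.2.1 w.2.2.1 w.2.2.2.1 w.2.2.2.2.1 w.2.2.2.2.2 := by
  unfold bigPoint
  fun_prop

theorem continuous_smoothPart (hH : Continuous (fun w : Euc m × Euc q => D.H w.1 w.2)) : Continuous
    fun w : Euc m × Euc q × Euc p × Euc p × Euc m × Euc p =>
      D.smoothPart w.1 w.2.1 w.2.2.1 w.2.2.2.1 w.2.2.2.2.1 w.2.2.2.2.2 := by
  unfold smoothPart
  have h : Continuous fun w : Euc m × Euc q × Euc p × Euc p × Euc m × Euc p => D.H w.1 w.2.1 :=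
    hH.comp (by fun_prop : Continuous fun w : Euc m × Euc q × Euc p × Euc p × Euc m × Euc p =>
      (w.1, w.2.1))
  fun_prop

theorem isBounded_range_bigSeq (hbx : Bornology.IsBounded (Set.range x))
    (hby : Bornology.IsBounded (Set.range y)) (hbz : Bornology.IsBounded (Set.range z))
    (hbu : Bornology.IsBounded (Set.range u)) :
    Bornology.IsBounded (Set.range (bigSeq x y z u)) := by
  have hc := (hbx.isCompact_closure.prod (hby.isCompact_closure.prod (hbz.isCompact_closure.prod
    (hbu.isCompact_closure.prod (hbx.isCompact_closure.prod hbu.isCompact_closure))))).image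
    continuous_bigPoint
  refine hc.isBounded.subset ?_
  rintro _ ⟨n, rfl⟩
  have hm : ∀ {d : ℕ} (v : ℕ → Euc d) (k : ℕ), v k ∈ closure (Set.range v) := fun v k =>
    subset_closure (Set.mem_range_self k)
  exact ⟨(x n, y n, z n, u n, x (n - 1), u (n - 1)), ⟨hm x n, hm y n, hm z n, hm u n, hm x _,
    hm u _⟩, rfl⟩

theorem Standing.C₀_nonneg (hp : 0 < p) (hD : D.Standing) : 0 ≤ D.C₀ := by
  have := lamMin_pos hp hD.A_surj
  have := hD.β_pos
  have := sub_nonneg.2 hD.σ_le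
  unfold C₀
  positivity

theorem Standing.C₁_nonneg (hp : 0 < p) (hD : D.Standing) : 0 ≤ D.C₁ := by
  have := lamMin_pos hp hD.A_surj
  have := hD.β_pos
  have := hD.σ_pos
  unfold C₁
  positivity

theorem Generates.exists_le_psiVal (hp : 0 < p) (hgen : D.Generates x y z u) (hD : D.Standing)
    (hbx : Bornology.IsBounded (Set.range x)) (hbz : Bornology.IsBounded (Set.range z))
    (hbu : Bornology.IsBounded (Set.range u)) :
    ∃ b : ℝ, ∀ n, 1 ≤ n → b ≤ D.psiVal x y z u n := by
  obtain ⟨cF, hF⟩ := hD.F_bdd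
  obtain ⟨cG, hG⟩ := hD.G_bdd
  obtain ⟨cH, hH⟩ := hD.H_bdd
  obtain ⟨Rx, hRx⟩ := hbx.exists_norm_le
  obtain ⟨Rz, hRz⟩ := hbz.exists_norm_le
  obtain ⟨Ru, hRu⟩ := hbu.exists_norm_le
  refine ⟨cF + cG + cH - Ru * (‖D.A‖ * Rx + Rz), fun n hn => ?_⟩
  have h1 : cF ≤ (D.F (z n)).toReal := by
    have := hF (z n)
    rw [← EReal.coe_toReal (hgen.F_ne_top hD hn) (hD.F_proper.1 _)] at this
    exact_mod_cast this
  have h2 : cG ≤ (D.G (y n)).toReal := by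
    have := hG (y n)
    rw [← EReal.coe_toReal (hgen.G_ne_top hD hn) (hD.G_proper.1 _)] at this
    exact_mod_cast this
  have h3 := hH (x n) (y n)
  have h4 := (abs_le.1 (abs_inner_le_of_le (hRu _ (Set.mem_range_self n)) (norm_sub_le_of_le
    (D.A.le_opNorm_of_le (hRx _ (Set.mem_range_self n))) (hRz _ (Set.mem_range_self n))))).1
  have h5 : 0 ≤ D.β / 2 * ‖D.A (x n) - z n‖ ^ 2 := by
    have := hD.β_pos
    positivity
  have h6 := mul_nonneg (hD.C₀_nonneg hp)
    (sq_nonneg ‖D.At (u n - u (n - 1)) + D.σ • D.B (x n - x (n - 1))‖)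
  have h7 := mul_nonneg (hD.C₁_nonneg hp) (sq_nonneg ‖x n - x (n - 1)‖)
  unfold psiVal smoothPart
  linarith

/-- The length of the step that leads to the `n`-th iterate. -/
def stepLength (x : ℕ → Euc m) (y : ℕ → Euc q) (u : ℕ → Euc p) (n : ℕ) : ℝ :=
  ‖x n - x (n - 1)‖ + ‖y n - y (n - 1)‖ + ‖u n - u (n - 1)‖

theorem Generates.exists_isDescentSequence (hp : 0 < p) (hgen : D.Generates x y z u)
    (hD : D.Standing) {B₁ : Set (Euc m)} {B₂ : Set (Euc q)} (hB₁ : Convex ℝ B₁)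
    (hB₂ : Convex ℝ B₂) (hxB : ∀ n, x n ∈ B₁) (hyB : ∀ n, y n ∈ B₂)
    (hLip : D.GradLipschitzOn B₁ B₂) :
    ∃ c K : ℝ, IsDescentSequence D.Psi (bigSeq x y z u) (D.psiVal x y z u) (stepLength x y u)
      c K := by
  obtain ⟨K, hK, hsub⟩ := hgen.exists_subgradient_bound hD hxB hyB hLip
  -- The 3 comes from (r + s + t)² ≤ 3(r² + s² + t²).
  refine ⟨min D.C₂ (min D.C₃ D.C₄) / 3, K, div_pos hD.C_pos three_pos, hK,
    fun n => by unfold stepLength; positivity, fun n hn => hgen.Psi_bigSeq hD hn, fun n hn => ?_,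
    fun n hn => ?_⟩
  · refine le_trans ?_ (hgen.psiVal_descent hp hD hB₁ hB₂ hxB hyB hLip hn)
    have hc := hD.C_pos
    set c := min D.C₂ (min D.C₃ D.C₄) with hcdef
    have h2 : c ≤ D.C₂ := min_le_left _ _
    have h3 : c ≤ D.C₃ := (min_le_right _ _).trans (min_le_left _ _)
    have h4 : c ≤ D.C₄ := (min_le_right _ _).trans (min_le_right _ _)
    have key : ∀ r s t : ℝ, c / 3 * (r + s + t) ^ 2 ≤ D.C₂ * r ^ 2 + D.C₃ * s ^ 2 + D.C₄ * t ^ 2 := by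
      intro r s t
      have e : (r + s + t) ^ 2 ≤ 3 * (r ^ 2 + s ^ 2 + t ^ 2) := by
        nlinarith [sq_nonneg (r - s), sq_nonneg (s - t), sq_nonneg (r - t)]
      have e2 := mul_le_mul_of_nonneg_left e (show 0 ≤ c / 3 by positivity)
      have f2 := mul_le_mul_of_nonneg_right h2 (sq_nonneg r)
      have f3 := mul_le_mul_of_nonneg_right h3 (sq_nonneg s)
      have f4 := mul_le_mul_of_nonneg_right h4 (sq_nonneg t)
      linarith
    exact key _ _ _
  · obtain ⟨n, rfl⟩ := Nat.exists_eq_add_of_le' hn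
    exact hsub n

theorem GradLipschitzOn.exists_norm_gradY_le {B₁ : Set (Euc m)} {B₂ : Set (Euc q)} (hL : 0 ≤ D.L)
    (hbx : Bornology.IsBounded (Set.range x)) (hby : Bornology.IsBounded (Set.range y))
    (hxB : ∀ n, x n ∈ B₁) (hyB : ∀ n, y n ∈ B₂) (hLip : D.GradLipschitzOn B₁ B₂) :
    ∃ R : ℝ, ∀ n, ‖D.gradY (x n) (y n)‖ ≤ R := by
  obtain ⟨Rx, hRx⟩ := hbx.exists_norm_le
  obtain ⟨Ry, hRy⟩ := hby.exists_norm_le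
  refine ⟨‖D.gradY (x 0) (y 0)‖ + D.L * ((Rx + Rx) + (Ry + Ry)), fun n => ?_⟩
  have h1 := hLip.gradY_sub_le hL (hxB n) (hyB n) (hxB 0) (hyB 0)
  have h2 := add_le_add
    (norm_sub_le_of_le (hRx _ (Set.mem_range_self n)) (hRx _ (Set.mem_range_self 0)))
    (norm_sub_le_of_le (hRy _ (Set.mem_range_self n)) (hRy _ (Set.mem_range_self 0)))
  have h3 := norm_le_norm_add_norm_sub' (D.gradY (x n) (y n)) (D.gradY (x 0) (y 0))
  have h4 := mul_le_mul_of_nonneg_left h2 hL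
  linarith

/-- F and G are only lower semicontinuous; testing the minimality of z (k i) and y (k i) against the
limit point supplies the missing upper bound. -/
theorem Generates.tendsto_Psi_of_tendsto (hgen : D.Generates x y z u) (hD : D.Standing)
    (hs : Tendsto (stepLength x y u) atTop (𝓝 0)) {R : ℝ}
    (hR : ∀ n, ‖D.gradY (x n) (y n)‖ ≤ R) {k : ℕ → ℕ} (hk : Tendsto k atTop atTop)
    (hk1 : ∀ i, 1 ≤ k i) {w : BigSpace m q p}
    (hw : Tendsto (fun i => bigSeq x y z u (k i)) atTop (𝓝 w)) :
    Tendsto (fun i => D.Psi (bigSeq x y z u (k i))) atTop (𝓝 (D.Psi w)) := by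
  have hx : Tendsto (fun i => x (k i)) atTop (𝓝 w.fst) :=
    ((by fun_prop : Continuous fun v : BigSpace m q p => v.fst).tendsto w).comp hw
  have hy : Tendsto (fun i => y (k i)) atTop (𝓝 w.snd.fst) :=
    ((by fun_prop : Continuous fun v : BigSpace m q p => v.snd.fst).tendsto w).comp hw
  have hz : Tendsto (fun i => z (k i)) atTop (𝓝 w.snd.snd.fst) :=
    ((by fun_prop : Continuous fun v : BigSpace m q p => v.snd.snd.fst).tendsto w).comp hw
  have hu : Tendsto (fun i => u (k i)) atTop (𝓝 w.snd.snd.snd.fst) :=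
    ((by fun_prop : Continuous fun v : BigSpace m q p => v.snd.snd.snd.fst).tendsto w).comp hw
  have hx' : Tendsto (fun i => x (k i - 1)) atTop (𝓝 w.snd.snd.snd.snd.fst) :=
    ((by fun_prop : Continuous fun v : BigSpace m q p => v.snd.snd.snd.snd.fst).tendsto w).comp hw
  have hu' : Tendsto (fun i => u (k i - 1)) atTop (𝓝 w.snd.snd.snd.snd.snd) :=
    ((by fun_prop : Continuous fun v : BigSpace m q p => v.snd.snd.snd.snd.snd).tendsto w).comp hw
  have hΔy : Tendsto (fun i => y (k i) - y (k i - 1)) atTop (𝓝 0) :=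
    squeeze_zero_norm (fun i => by
      unfold stepLength
      simp only [Function.comp]
      linarith [norm_nonneg (x (k i) - x (k i - 1)), norm_nonneg (u (k i) - u (k i - 1))])
      (hs.comp hk)
  -- Unlike x and u, the previous y is not a coordinate of X_n; its limit comes from the vanishing
  -- steps.
  have hy' : Tendsto (fun i => y (k i - 1)) atTop (𝓝 w.snd.fst) := by
    simpa using hy.sub hΔy
  have hsucc : ∀ i, k i - 1 + 1 = k i := fun i => Nat.sub_add_cancel (hk1 i)
  have hF : Tendsto (fun i => D.F (z (k i))) atTop (𝓝 (D.F w.snd.snd.fst)) := by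
    refine tendsto_of_lowerSemicontinuousAt_of_le (hD.F_lsc _) hz
      (r := fun i => (inner ℝ (u (k i - 1)) (D.A (x (k i - 1)) - w.snd.snd.fst) +
        D.β / 2 * ‖D.A (x (k i - 1)) - w.snd.snd.fst‖ ^ 2) -
        (inner ℝ (u (k i - 1)) (D.A (x (k i - 1)) - z (k i)) +
        D.β / 2 * ‖D.A (x (k i - 1)) - z (k i)‖ ^ 2)) ?_ (Eventually.of_forall fun i => ?_)
    · have hA := (D.A.continuous.tendsto _).comp hx'
      have h1 := hA.sub_const w.snd.snd.fst
      have h2 := hA.sub hz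
      have := ((hu'.inner h1).add ((h1.norm.pow 2).const_mul (D.β / 2))).sub
        ((hu'.inner h2).add ((h2.norm.pow 2).const_mul (D.β / 2)))
      rw [sub_self] at this
      exact this
    · have := (hgen.z_step (k i - 1)).le_add_coe_sub hD.F_proper w.snd.snd.fst
      rw [hsucc] at this
      exact this
  have hG : Tendsto (fun i => D.G (y (k i))) atTop (𝓝 (D.G w.snd.fst)) := by
    refine tendsto_of_lowerSemicontinuousAt_of_le (hD.G_lsc _) hy
      (r := fun i => (inner ℝ (D.gradY (x (k i - 1)) (y (k i - 1))) w.snd.fst +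
        D.μ / 2 * ‖w.snd.fst - y (k i - 1)‖ ^ 2) -
        (inner ℝ (D.gradY (x (k i - 1)) (y (k i - 1))) (y (k i)) +
        D.μ / 2 * ‖y (k i) - y (k i - 1)‖ ^ 2)) ?_ (Eventually.of_forall fun i => ?_)
    -- Boundedness of the gradients suffices; the limit may lie outside B₁ × B₂, where ∇H need not
    -- be continuous.
    · have h1 : Tendsto (fun i => inner ℝ (D.gradY (x (k i - 1)) (y (k i - 1)))
          (w.snd.fst - y (k i))) atTop (𝓝 0) := by
        have h2 : Tendsto (fun i => R * ‖w.snd.fst - y (k i)‖) atTop (𝓝 0) := by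
          have := ((hy.const_sub w.snd.fst).norm).const_mul R
          simpa using this
        exact squeeze_zero_norm (fun i => abs_inner_le_of_le (hR _) le_rfl) h2
      have h3 := (((hy'.const_sub w.snd.fst).norm.pow 2).const_mul (D.μ / 2))
      have h4 := ((hΔy.norm.pow 2).const_mul (D.μ / 2))
      have h5 := (h1.add h3).sub h4
      simp only [sub_self, norm_zero, zero_pow two_ne_zero, mul_zero, add_zero] at h5
      refine h5.congr fun i => ?_
      rw [inner_sub_right]
      ring
    · have := (hgen.y_step (k i - 1)).le_add_coe_sub hD.G_proper w.snd.fst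
      rw [hsucc] at this
      exact this
  have hS := ((continuous_smoothPart (D := D) hD.H_diff.continuous).tendsto
    (w.fst, w.snd.fst, w.snd.snd.fst, w.snd.snd.snd.fst, w.snd.snd.snd.snd.fst,
      w.snd.snd.snd.snd.snd)).comp (hx.prodMk_nhds (hy.prodMk_nhds (hz.prodMk_nhds
      (hu.prodMk_nhds (hx'.prodMk_nhds hu')))))
  have hFG : Tendsto (fun i => D.F (z (k i)) + D.G (y (k i))) atTop
      (𝓝 (D.F w.snd.snd.fst + D.G w.snd.fst)) :=
    (EReal.continuousAt_add (p := (D.F w.snd.snd.fst, D.G w.snd.fst))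
      (Or.inr (hD.G_proper.1 _)) (Or.inl (hD.F_proper.1 _))).tendsto.comp (hF.prodMk_nhds hG)
  exact (EReal.continuousAt_add (p := (D.F w.snd.snd.fst + D.G w.snd.fst, ((D.smoothPart w.fst
    w.snd.fst w.snd.snd.fst w.snd.snd.snd.fst w.snd.snd.snd.snd.fst w.snd.snd.snd.snd.snd : ℝ) :
    EReal))) (Or.inr (EReal.coe_ne_bot _)) (Or.inr (EReal.coe_ne_top _))).tendsto.comp
    (hFG.prodMk_nhds ((continuous_coe_real_ereal.tendsto _).comp hS))

theorem cauchySeq_of_norm_sub_le_stepLength {d : ℕ} {v : ℕ → Euc d}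
    (hv : ∀ n, ‖v n - v (n - 1)‖ ≤ stepLength x y u n) (hs : Summable (stepLength x y u)) :
    ∃ a, Tendsto v atTop (𝓝 a) := by
  refine cauchySeq_tendsto_of_complete (cauchySeq_of_dist_le_of_summable
    (fun n => stepLength x y u (n + 1)) (fun n => ?_) ((summable_nat_add_iff 1).2 hs))
  rw [dist_comm, dist_eq_norm]
  exact hv (n + 1)

theorem Generates.exists_tendsto_bigSeq (hgen : D.Generates x y z u) (hD : D.Standing)
    (hs : Summable (stepLength x y u)) : ∃ w, Tendsto (bigSeq x y z u) atTop (𝓝 w) := by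
  have hnx := fun n => norm_nonneg (x n - x (n - 1))
  have hny := fun n => norm_nonneg (y n - y (n - 1))
  have hnu := fun n => norm_nonneg (u n - u (n - 1))
  obtain ⟨a, ha⟩ := cauchySeq_of_norm_sub_le_stepLength (v := x)
    (fun n => by unfold stepLength; linarith [hny n, hnu n]) hs
  obtain ⟨b, hb⟩ := cauchySeq_of_norm_sub_le_stepLength (v := y)
    (fun n => by unfold stepLength; linarith [hnx n, hnu n]) hs
  obtain ⟨e, he⟩ := cauchySeq_of_norm_sub_le_stepLength (v := u)
    (fun n => by unfold stepLength; linarith [hny n, hnx n]) hs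
  have ha' : Tendsto (fun n => x (n - 1)) atTop (𝓝 a) := ha.comp (tendsto_sub_atTop_nat 1)
  have he' : Tendsto (fun n => u (n - 1)) atTop (𝓝 e) := he.comp (tendsto_sub_atTop_nat 1)
  -- No step of z is controlled directly; the dual step writes z as A x minus a multiple of the dual
  -- increment.
  have hz : Tendsto z atTop (𝓝 (D.A a - (D.σ * D.β)⁻¹ • (e - e))) := by
    refine (((D.A.continuous.tendsto a).comp ha).sub ((he.sub he').const_smul _)).congr' ?_
    filter_upwards [eventually_ge_atTop 1] with n hn
    obtain ⟨n, rfl⟩ := Nat.exists_eq_add_of_le' hn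
    have := hgen.residual_eq hD.σ_pos hD.β_pos n
    simp only [Function.comp, Nat.add_sub_cancel]
    rw [← this, sub_sub_cancel]
  exact ⟨_, (continuous_bigPoint.tendsto (a, b, _, e, a, e)).comp (ha.prodMk_nhds (hb.prodMk_nhds
    (hz.prodMk_nhds (he.prodMk_nhds (ha'.prodMk_nhds he')))))⟩

end SplitData

end

/-! ### Convergence and rates -/

theorem mainTheorem4 {m q p : ℕ} (hp : 0 < p) (D : SplitData m q p) (hD : D.Standing)
    (x : ℕ → Euc m) (y : ℕ → Euc q) (z u : ℕ → Euc p) (hgen : D.Generates x y z u)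
    (hbx : Bornology.IsBounded (Set.range x)) (hby : Bornology.IsBounded (Set.range y))
    (hbz : Bornology.IsBounded (Set.range z)) (hbu : Bornology.IsBounded (Set.range u))
    (B₁ : Set (Euc m)) (B₂ : Set (Euc q))
    (hB₁ : Convex ℝ B₁) (hB₂ : Convex ℝ B₂)
    (hB₁b : Bornology.IsBounded B₁) (hB₂b : Bornology.IsBounded B₂)
    (hxB : ∀ n, x n ∈ B₁) (hyB : ∀ n, y n ∈ B₂)
    (hLip : D.GradLipschitzOn B₁ B₂)
    (hLoj : HasLojasiewiczProperty D.Psi) :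
    ∃ (Xs : BigSpace m q p) (Ps : ℝ),
      Tendsto (bigSeq x y z u) atTop (𝓝 Xs) ∧
      Tendsto (fun n => D.Psi (bigSeq x y z u n)) atTop (𝓝 (Ps : EReal)) ∧
      D.Psi Xs = (Ps : EReal) ∧
      ∀ CL θ : ℝ, 0 < CL → 0 ≤ θ → θ < 1 → LojasiewiczAt D.Psi Xs CL θ →
        (θ = 0 → ∃ n₀ : ℕ, 1 ≤ n₀ ∧ ∀ n, n₀ ≤ n → D.Psi (bigSeq x y z u n) = (Ps : EReal)) ∧
        (0 < θ → θ ≤ 1 / 2 → ∃ n₀ : ℕ, 1 ≤ n₀ ∧ ∃ C Q : ℝ, 0 < C ∧ 0 ≤ Q ∧ Q < 1 ∧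
          ∀ n, n₀ ≤ n →
            0 ≤ D.Psi (bigSeq x y z u n) - (Ps : EReal) ∧
            D.Psi (bigSeq x y z u n) - (Ps : EReal) ≤ ((C * Q ^ n : ℝ) : EReal)) ∧
        (1 / 2 < θ → ∃ n₀ : ℕ, 1 ≤ n₀ ∧ ∃ C : ℝ, 0 < C ∧
          ∀ n, n₀ + 1 ≤ n →
            0 ≤ D.Psi (bigSeq x y z u n) - (Ps : EReal) ∧
            D.Psi (bigSeq x y z u n) - (Ps : EReal) ≤
              ((C * (n : ℝ) ^ (-(1 / (2 * θ - 1))) : ℝ) : EReal)) := by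

  obtain ⟨c, K, hseq⟩ := hgen.exists_isDescentSequence hp hD hB₁ hB₂ hxB hyB hLip
  obtain ⟨b, hb⟩ := hgen.exists_le_psiVal hp hD hbx hbz hbu
  obtain ⟨Ps, hφ, hle⟩ := hseq.exists_tendsto_value hb
  obtain ⟨R, hR⟩ := SplitData.GradLipschitzOn.exists_norm_gradY_le hD.L_pos.le hbx hby hxB hyB hLip
  have hcluster : ∀ (k : ℕ → ℕ) (w : BigSpace m q p), Tendsto k atTop atTop → (∀ i, 1 ≤ k i) →
      Tendsto (fun i => bigSeq x y z u (k i)) atTop (𝓝 w) → D.Psi w = Ps := by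
    intro k w hk hk1 hw
    refine tendsto_nhds_unique (hgen.tendsto_Psi_of_tendsto hD (hseq.tendsto_step hφ) hR hk hk1 hw)
      ?_
    simp only [fun i => hseq.value (k i) (hk1 i)]
    exact (continuous_coe_real_ereal.tendsto _).comp (hφ.comp hk)
  have hsum := hseq.summable_step hφ hle
    (SplitData.isBounded_range_bigSeq hbx hby hbz hbu) hcluster hLoj
  obtain ⟨Xs, hXs⟩ := hgen.exists_tendsto_bigSeq hD hsum
  have hPs : D.Psi Xs = Ps := hcluster (fun i => i + 1) Xs (tendsto_add_atTop_nat 1)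
    (fun i => Nat.le_add_left 1 i) (hXs.comp (tendsto_add_atTop_nat 1))
  have hval : ∀ n, 1 ≤ n → D.Psi (bigSeq x y z u n) - (Ps : EReal) =
      ((D.psiVal x y z u n - Ps : ℝ) : EReal) := fun n hn => by
    rw [hseq.value n hn, EReal.coe_sub]
  have hnonneg : ∀ n, 1 ≤ n → 0 ≤ D.Psi (bigSeq x y z u n) - (Ps : EReal) := fun n hn => by
    rw [hval n hn]
    exact_mod_cast sub_nonneg.2 (hle n hn)
  refine ⟨Xs, Ps, hXs, ?_, hPs, fun CL θ hCL hθ0 hθ1 hL => ⟨?_, fun hθ hθ2 => ?_, fun hθ => ?_⟩⟩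
  -- Only eventual equality is available: at n = 0 the value of Ψ may be +∞.
  · refine ((continuous_coe_real_ereal.tendsto _).comp hφ).congr' ?_
    filter_upwards [eventually_ge_atTop 1] with n hn
    exact (hseq.value n hn).symm
  · rintro rfl
    obtain ⟨n₀, h1, h⟩ := hseq.finite_termination hφ hle hXs hPs hCL hL
    exact ⟨n₀, h1, fun n hn => by rw [hseq.value n (h1.trans hn), h n hn]⟩
  · obtain ⟨n₀, h1, C, Q, hC, hQ0, hQ1, h⟩ := hseq.linear_rate hφ hle hXs hPs hCL hθ hθ2 hL
    refine ⟨n₀, h1, C, Q, hC, hQ0, hQ1, fun n hn => ⟨hnonneg n (h1.trans hn), ?_⟩⟩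
    rw [hval n (h1.trans hn)]
    exact EReal.coe_le_coe_iff.2 (h n hn)
  · obtain ⟨n₀, h1, C, hC, h⟩ := hseq.sublinear_rate hφ hle hXs hPs hCL hθ hθ1 hL
    refine ⟨n₀, h1, C, hC, fun n hn => ?_⟩
    -- The estimate already holds from n₀ on.
    have hn' : n₀ ≤ n := n₀.le_succ.trans hn
    refine ⟨hnonneg n (h1.trans hn'), ?_⟩
    rw [hval n (h1.trans hn')]
    exact EReal.coe_le_coe_iff.2 (h n hn')
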